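/- **Conventions.** Write $[N]=\{1,\dots,N\}$. The length of a directed path is its number of nodes. A directed graph $G=(V,E)$ is $(e,d)$-depth-robust ($e\in\mathbb N$, $d\in\mathbb R$) if for every $S\subseteq V$ with $|S|\le e$ the graph $G-S$ contains a directed path with at least $d$ (distinct) nodes (a trivial requirement when $d\le 0$). **Construction.** For $m\ge 1$ identify $(x,y)\in\{0,\dots,m-1\}^2$ with the integer $xm+y+1\in[m^2]$, and let $\sigma'_0,\dots,\sigma'_4$ be the permutations of $[m^2]$ that correspond under this identification to $$(x,y)\mapsto (x,y),\quad (x,x+y),\quad (x,x+y+1),\quad (x+y,y),\quad (x+y+1,y)\qquad (\text{addition mod } m).$$ Put $\mathsf{GetParentsGG}(m,j)=\{\sigma'_0(j),\dots,\sigma'_4(j)\}$, $\mathsf{GetParentsLayered}^{1}(m,j)=\mathsf{GetParentsGG}(m,j)$ and $$\mathsf{GetParentsLayered}^{i+1}(m,j)=\bigcup_{j'\in\mathsf{GetParentsGG}(m,j)}\mathsf{GetParentsLayered}^{i}(m,j').$$ Let $d_0=(2-\sqrt3)/4$ and $L_\delta=\left\lceil \frac{\log((1-\delta)/\delta)}{\log(1+d_0\delta)}\right\rceil+1$,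 let $m(N)$ be the least positive integer $m$ with $m^2\ge N$, and put $$\mathsf{GetParentsBE}(N,\delta,j)=[N]\cap \mathsf{GetParentsLayered}^{L_{\delta/2}}(m(N),j).$$ For $N=2^n$ and $v\in[N]$ let $\mathsf{GetParentsEGS}(\delta,v,N)$ be the intersection with $[N]$ of $$\{v-4n,\dots,v-1\}\ \cup\ \bigcup_{t=1}^{\lceil\log_2 v\rceil}\Big\{(m_t-i)2^t+y \;:\; y\in\mathsf{GetParentsBE}\big(2^t,\tfrac{\delta}{5},(v\bmod 2^t)+1\big),\ 1\le i\le\min\{m_t,10\}\Big\},\qquad m_t=\lfloor v/2^t\rfloor .$$ Let $G(\delta,N)$ be the graph on $[N]$ with edge set $\{(u,v): v\in[N],\ u\in\mathsf{GetParentsEGS}(\delta,v,N),\ u\ne v\}$ (all its edges satisfy $u<v$, so it is a DAG). **Corollary.** Let $0<\delta<1/4$ and $2\delta<\gamma<1$, and let $N=2^n$ with $n\ge 0$ an integer. Then for every integer $0\le e\le N$ the graph $G(\delta,N)$ is $\left(e,\ N-e\,\frac{1+\gamma}{1-\gamma}\right)$-depth-robust. -/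

import Mathlib

namespace DepthRobust

/-- Longest-path robustness of a directed graph. The length of a path is its number of nodes.
`G` is `(e, d)`-depth-robust if for every set `S` of at most `e` nodes, `G - S` still contains a
directed path with at least `d` nodes. -/
def IsDepthRobust {V : Type*} (G : Digraph V) (e : ℕ) (d : ℝ) : Prop :=
  ∀ S : Finset V, S.card ≤ e →
    ∃ p : List V, p.IsChain G.Adj ∧ p.Nodup ∧ (∀ v ∈ p, v ∉ S) ∧ d ≤ (p.length : ℝ)

/-! ### The bipartite expanders of Gabber and Galil on `{1, …, m ^ 2}` -/

/-- The bijection from `{0, …, m - 1} × {0, …, m - 1}` to `{1, …, m ^ 2}`. -/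
def pairToInt (m : ℕ) (p : ℕ × ℕ) : ℕ := p.1 * m + p.2 + 1

/-- The inverse of `pairToInt m`. -/
def intToPair (m z : ℕ) : ℕ × ℕ := ((z - 1) / m, (z - 1) % m)

/-- The five permutations `σ₀, …, σ₄` of `{0, …, m - 1} × {0, …, m - 1}`. -/
def sigma (m : ℕ) (k : Fin 5) (p : ℕ × ℕ) : ℕ × ℕ :=
  match k with
  | 0 => (p.1, p.2)
  | 1 => (p.1, (p.1 + p.2) % m)
  | 2 => (p.1, (p.1 + p.2 + 1) % m)
  | 3 => ((p.1 + p.2) % m, p.2)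
  | 4 => ((p.1 + p.2 + 1) % m, p.2)

/-- The parents of the node `j` in the Gabber–Galil graph. -/
def getParentsGG (m j : ℕ) : Finset ℕ :=
  Finset.univ.image fun k : Fin 5 => pairToInt m (sigma m k (intToPair m j))

/-- The parents of `j` after collapsing `i` stacked copies of the Gabber–Galil graph.
With `0` copies the only parent of `j` is `j` itself, so that one copy gives `getParentsGG m j`. -/
def getParentsLayered : ℕ → ℕ → ℕ → Finset ℕ
  | 0, _, j => {j}
  | i + 1, m, j => (getParentsGG m j).biUnion fun j' => getParentsLayered i m j'

/-- The expansion constant `(2 - √3) / 4` of the Gabber–Galil graphs. -/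
noncomputable def gabberGalilConst : ℝ := (2 - √3) / 4

/-- The number of layers `L_δ = ⌈log ((1 - δ) / δ) / log (1 + d δ)⌉ + 1`. -/
noncomputable def numLayers (δ : ℝ) : ℕ :=
  ⌈Real.log ((1 - δ) / δ) / Real.log (1 + gabberGalilConst * δ)⌉₊ + 1

/-- The smallest positive integer `m` with `N ≤ m ^ 2`. -/
noncomputable def ceilSqrt (N : ℕ) : ℕ := sInf {m : ℕ | 0 < m ∧ N ≤ m ^ 2}

/-- The parents of `j` in the truncated layered graph on `N` sources and `N` sinks. -/
noncomputable def getParentsBE (N : ℕ) (δ : ℝ) (j : ℕ) : Finset ℕ :=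
  Finset.Icc 1 N ∩ getParentsLayered (numLayers (δ / 2)) (ceilSqrt N) j

/-! ### The graph `G(δ, N)` -/

/-- The parents of the node `v` in `G(δ, N)`, where `N = 2 ^ n`. -/
noncomputable def getParentsEGS (δ : ℝ) (v N : ℕ) : Finset ℕ :=
  (Finset.Icc (v - 4 * Nat.log 2 N) (v - 1) ∪
    (Finset.Icc 1 (Nat.clog 2 v)).biUnion fun t =>
      (getParentsBE (2 ^ t) (δ / 5) (v % 2 ^ t + 1)).biUnion fun y =>
        (Finset.Icc 1 (min (v / 2 ^ t) 10)).image fun i => (v / 2 ^ t - i) * 2 ^ t + y)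
    ∩ Finset.Icc 1 N

/-- The graph `G(δ, N)` on `{1, …, N}`. The procedure `getParentsEGS` may list a node `v` as its
own parent; such loops are not edges of the directed acyclic graph. -/
def egsGraph (δ : ℝ) (N : ℕ) : Digraph (Finset.Icc 1 N) where
  Adj u v := (u : ℕ) ∈ getParentsEGS δ v N ∧ u ≠ v

/-- Every edge of `G(δ, N)` goes from a smaller to a larger node; in particular the graph is
acyclic. -/
theorem egsGraph_adj_lt {δ : ℝ} {N : ℕ} {u v : Finset.Icc 1 N} (h : (egsGraph δ N).Adj u v) :
    u < v := by
  obtain ⟨h, hne⟩ := h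
  refine lt_of_le_of_ne ?_ hne
  have hv := (Finset.mem_Icc.1 v.2).1
  rw [← Subtype.coe_le_coe]
  simp only [getParentsEGS, getParentsBE, Finset.mem_inter, Finset.mem_union, Finset.mem_biUnion,
    Finset.mem_image, Finset.mem_Icc] at h
  obtain ⟨h | ⟨t, -, y, ⟨⟨-, hy⟩, -⟩, i, ⟨hi, hi'⟩, h⟩, -⟩ := h
  · omega
  · have h1 : v / 2 ^ t - i + 1 ≤ (v : ℕ) / 2 ^ t := by
      have := hi'.trans (min_le_left _ _)
      omega
    calc (u : ℕ) ≤ (v / 2 ^ t - i + 1) * 2 ^ t := by rw [← h, add_mul]; omega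
      _ ≤ (v : ℕ) / 2 ^ t * 2 ^ t := Nat.mul_le_mul_right _ h1
      _ ≤ v := Nat.div_mul_le_self _ _

end DepthRobust

/-! Everything rests on one local property (`egs_local_expander`): with `c = 3δ/5`, if two adjacent
intervals of equal length `r` contain sets `X`, `Y` of at least `c * r` nodes each, some edge runs
from `X` to `Y`.

Given this property, delete `S` and call a node good if every interval ending or starting at it
keeps the proportion `γ` of its nodes. A covering argument leaves at least `N - |S|(1+γ)/(1-γ)` good
nodes (`card_good_ge`). Since `3c ≤ γ`, repeated doubling shows that a good node `u` reaches at
least the proportion `γ - 2c ≥ c` of every interval starting at it, and a good node `v` is reached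
from that much of every interval ending at it. For `u < v` both good, these two sets meet across the
middle (`card_reached_ge`, `connected_of_good`). Joining consecutive good nodes gives one path
through all of them.

The local property is multiscale. Short intervals are covered by the edges to the last `4n` nodes.
For longer ones, either the halves next to the common boundary are dense and induction applies, or
one outer half is dense; then pigeonhole yields two dense dyadic blocks, and the bipartite expander
between these blocks supplies the edge.

The bipartite expander comes from the spectral gap of the Gabber–Galil permutations
(`gabberGalil_gap`). In Fourier space they become shears of the dual torus with phases, and a
weighted AM-GM inequality bounds the cross terms. The gap gives vertex expansion; each layer then
multiplies the odds `y / (m² - y)` of a set of size `y` by at least `25/24`, and the prescribed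
number of layers takes density `η` beyond `1 - η`. -/

namespace DepthRobust

/-! ### Weights on the dual torus -/

/-- The weight given to the edge from `u` to `v` when bounding the Gabber–Galil operator. -/
noncomputable def edgeWeight (u v : ℤ × ℤ) : ℝ :=
  -- Moves that enlarge the max norm are cheap and their reverses are dear. At equal norm, leaving
  -- the axes is cheap. The values are balanced so that the four edges at any nonzero point cost at
  -- most `23/6`.
  if max u.1.natAbs u.2.natAbs < max v.1.natAbs v.2.natAbs then 3 / 4
  else if max v.1.natAbs v.2.natAbs < max u.1.natAbs u.2.natAbs then 4 / 3
  else if (u.1 = 0 ∨ u.2 = 0) ∧ ¬ (v.1 = 0 ∨ v.2 = 0) then 6 / 7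
  else if ¬ (u.1 = 0 ∨ u.2 = 0) ∧ (v.1 = 0 ∨ v.2 = 0) then 7 / 6
  else 1

theorem edgeWeight_pos (u v : ℤ × ℤ) : 0 < edgeWeight u v := by
  unfold edgeWeight
  split_ifs <;> norm_num

theorem edgeWeight_le (u v : ℤ × ℤ) : edgeWeight u v ≤ 4 / 3 := by
  unfold edgeWeight
  split_ifs <;> norm_num

theorem edgeWeight_mul_swap (u v : ℤ × ℤ) : edgeWeight u v * edgeWeight v u = 1 := by
  unfold edgeWeight
  split_ifs <;> first | (exfalso; omega) | (exfalso; tauto) | norm_num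

theorem edgeWeight_of_lt {u v : ℤ × ℤ} (h : max u.1.natAbs u.2.natAbs < max v.1.natAbs v.2.natAbs) :
    edgeWeight u v = 3 / 4 := if_pos h

theorem edgeWeight_le_one {u v : ℤ × ℤ} (h : max u.1.natAbs u.2.natAbs = max v.1.natAbs v.2.natAbs)
    (h' : u.1 = 0 ∨ u.2 = 0 ∨ (v.1 ≠ 0 ∧ v.2 ≠ 0)) : edgeWeight u v ≤ 1 := by
  unfold edgeWeight
  split_ifs <;> first | (exfalso; omega) | (exfalso; tauto) | norm_num

theorem edgeWeight_le_seven_sixths {u v : ℤ × ℤ} (h : max u.1.natAbs u.2.natAbs = max v.1.natAbs v.2.natAbs) :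
    edgeWeight u v ≤ 7 / 6 := by
  unfold edgeWeight
  split_ifs <;> first | (exfalso; omega) | norm_num

theorem edgeWeight_of_axis {u v : ℤ × ℤ} (h : max u.1.natAbs u.2.natAbs = max v.1.natAbs v.2.natAbs)
    (hu : u.1 = 0 ∨ u.2 = 0) (hv : v.1 ≠ 0 ∧ v.2 ≠ 0) : edgeWeight u v = 6 / 7 := by
  unfold edgeWeight
  rw [if_neg h.not_lt, if_neg h.not_gt, if_pos ⟨hu, by tauto⟩]

theorem edgeWeight_swap (u v : ℤ × ℤ) : edgeWeight u.swap v.swap = edgeWeight u v := by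
  simp only [edgeWeight, Prod.fst_swap, Prod.snd_swap, max_comm u.2.natAbs, max_comm v.2.natAbs,
    or_comm (a := u.2 = 0), or_comm (a := v.2 = 0)]

/-- Exactly one of `|p + q|`, `|p - q|` equals `|p| + |q|`; that edge raises the max norm and costs
`3/4`. The other has absolute value `||p| - |q||`, which decides the second term. -/
theorem edgeWeight_add_edgeWeight_le {p q : ℤ} (hp : p ≠ 0) (hq : q ≠ 0) :
    edgeWeight (p, q) (p - q, q) + edgeWeight (p, q) (p + q, q) ≤
      3 / 4 + if q.natAbs < p.natAbs then 4 / 3 else if p.natAbs < q.natAbs then 1 else 7 / 6 := by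
  have key : ∀ s : ℤ, s.natAbs = q.natAbs → (p + s).natAbs = max p.natAbs q.natAbs -
      min p.natAbs q.natAbs → edgeWeight (p, q) (p + s, q) ≤
      if q.natAbs < p.natAbs then 4 / 3 else if p.natAbs < q.natAbs then 1 else 7 / 6 := by
    intro s hs h
    split_ifs with h1 h2
    · exact edgeWeight_le _ _
    · refine edgeWeight_le_one ?_ (Or.inr (Or.inr ⟨?_, ?_⟩)) <;> simp only <;> omega
    · refine edgeWeight_le_seven_sixths ?_
      simp only
      omega
  by_cases h : (p + q).natAbs = p.natAbs + q.natAbs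
  · rw [edgeWeight_of_lt (u := (p, q)) (v := (p + q, q)) (by simp only; omega), add_comm, sub_eq_add_neg]
    gcongr
    exact key _ (by simp) (by omega)
  · rw [edgeWeight_of_lt (u := (p, q)) (v := (p - q, q)) (by simp only; omega)]
    gcongr
    exact key _ rfl (by omega)

theorem edgeWeight_add_edgeWeight_axis_le {q : ℤ} (hq : q ≠ 0) :
    edgeWeight (0, q) (0 - q, q) + edgeWeight (0, q) (0 + q, q) +
      (edgeWeight (0, q) (0, q - 0) + edgeWeight (0, q) (0, q + 0)) ≤ 23 / 6 := by
  have h1 := edgeWeight_of_axis (u := (0, q)) (v := (0 - q, q)) (by simp) (by simp) (by simpa)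
  have h2 := edgeWeight_of_axis (u := (0, q)) (v := (0 + q, q)) (by simp) (by simp) (by simpa)
  have h3 := edgeWeight_le_one (u := (0, q)) (v := (0, q - 0)) (by simp) (by simp)
  have h4 := edgeWeight_le_one (u := (0, q)) (v := (0, q + 0)) (by simp) (by simp)
  linarith

/-- The weights of the four edges at a nonzero lattice point sum to less than four. -/
theorem sum_edgeWeight_le (p q : ℤ) (h : p ≠ 0 ∨ q ≠ 0) :
    edgeWeight (p, q) (p - q, q) + edgeWeight (p, q) (p + q, q) +
      (edgeWeight (p, q) (p, q - p) + edgeWeight (p, q) (p, q + p)) ≤ 23 / 6 := by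
  have hsw : ∀ a b c d : ℤ, edgeWeight (a, b) (c, d) = edgeWeight (b, a) (d, c) :=
    fun a b c d => edgeWeight_swap (b, a) (d, c)
  rcases eq_or_ne p 0 with rfl | hp
  · exact edgeWeight_add_edgeWeight_axis_le (by simpa using h)
  rcases eq_or_ne q 0 with rfl | hq
  · have := edgeWeight_add_edgeWeight_axis_le hp
    rw [hsw 0 p, hsw 0 p, hsw 0 p, hsw 0 p] at this
    linarith
  have h1 := edgeWeight_add_edgeWeight_le hp hq
  have h2 := edgeWeight_add_edgeWeight_le hq hp
  rw [hsw q p, hsw q p] at h2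
  -- For `|p| ≠ |q|` the total is `2 · 3/4 + 4/3 + 1`, for `|p| = |q|` it is `2 · (3/4 + 7/6)`; both
  -- equal `23/6`.
  split_ifs at h1 h2 <;> first | (exfalso; omega) | linarith

/-! ### Fourier analysis on the torus `ZMod m × ZMod m` -/

section Torus

variable {m : ℕ} [NeZero m]

/-- The Fourier transform on `ZMod m × ZMod m`. -/
noncomputable def torusFourier (f : ZMod m × ZMod m → ℂ) (ξ : ZMod m × ZMod m) : ℂ :=
  ∑ z, f z * ZMod.stdAddChar (-(ξ.1 * z.1 + ξ.2 * z.2))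

/-- The shear `(x, y) ↦ (x, x + y + s)`. -/
def shearRight (s : ZMod m) : Equiv.Perm (ZMod m × ZMod m) where
  toFun z := (z.1, z.1 + z.2 + s)
  invFun z := (z.1, z.2 - z.1 - s)
  left_inv z := Prod.ext rfl (by ring)
  right_inv z := Prod.ext rfl (by ring)

/-- The shear `(x, y) ↦ (x + y + s, y)`. -/
def shearLeft (s : ZMod m) : Equiv.Perm (ZMod m × ZMod m) where
  toFun z := (z.1 + z.2 + s, z.2)
  invFun z := (z.1 - z.2 - s, z.2)
  left_inv z := Prod.ext (by ring) rfl
  right_inv z := Prod.ext (by ring) rfl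

theorem sum_stdAddChar_torus (z : ZMod m × ZMod m) :
    ∑ ξ : ZMod m × ZMod m, (ZMod.stdAddChar (ξ.1 * z.1 + ξ.2 * z.2) : ℂ) =
      if z = 0 then (m : ℂ) ^ 2 else 0 := by
  have h : ∀ b : ZMod m, ∑ a : ZMod m, (ZMod.stdAddChar (a * b) : ℂ) = if b = 0 then (m : ℂ) else 0 := by
    intro b
    rw [AddChar.sum_mulShift b (ZMod.isPrimitive_stdAddChar m)]
    split_ifs <;> simp [ZMod.card]
  rw [Fintype.sum_prod_type]
  simp only [AddChar.map_add_eq_mul]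
  simp only [← Finset.mul_sum, ← Finset.sum_mul, h]
  rcases z with ⟨a, b⟩
  simp only [Prod.mk_eq_zero]
  by_cases ha : a = 0 <;> by_cases hb : b = 0 <;> simp [ha, hb, sq]

theorem sum_norm_torusFourier_sq (f : ZMod m × ZMod m → ℂ) :
    ∑ ξ, ‖torusFourier f ξ‖ ^ 2 = (m : ℝ) ^ 2 * ∑ z, ‖f z‖ ^ 2 := by
  have h : ∀ ξ, ((‖torusFourier f ξ‖ ^ 2 : ℝ) : ℂ) = ∑ z, ∑ w, f z * (starRingEnd ℂ) (f w) *
      ZMod.stdAddChar (ξ.1 * (w - z).1 + ξ.2 * (w - z).2) := by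
    intro ξ
    rw [Complex.ofReal_pow, ← Complex.mul_conj', torusFourier, map_sum, Finset.sum_mul_sum]
    refine Finset.sum_congr rfl fun z _ => Finset.sum_congr rfl fun w _ => ?_
    rw [map_mul, ← AddChar.map_neg_eq_conj, mul_mul_mul_comm, ← AddChar.map_add_eq_mul]
    congr 2
    simp only [Prod.fst_sub, Prod.snd_sub]
    ring
  rw [← Complex.ofReal_inj]
  rw [Complex.ofReal_sum]
  simp only [h]
  rw [Finset.sum_comm]
  have h2 : ∀ z, ∑ ξ : ZMod m × ZMod m, ∑ w, f z * (starRingEnd ℂ) (f w) *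
      ZMod.stdAddChar (ξ.1 * (w - z).1 + ξ.2 * (w - z).2) = (m : ℂ) ^ 2 * ‖f z‖ ^ 2 := by
    intro z
    rw [Finset.sum_comm]
    simp only [← Finset.mul_sum, sum_stdAddChar_torus, sub_eq_zero]
    simp [Complex.mul_conj', mul_comm]
  simp only [h2]
  push_cast
  rw [Finset.mul_sum]

/-- The dual shear does not depend on the shift `s`, which only contributes a phase. Comparing `s =
0` with `s = 1` is what later produces the factor `‖1 + χ‖`. -/
theorem torusFourier_comp_shearRight (f : ZMod m × ZMod m → ℂ) (s : ZMod m) (ξ : ZMod m × ZMod m) :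
    torusFourier (f ∘ shearRight s) ξ =
      ZMod.stdAddChar (ξ.2 * s) * torusFourier f (ξ.1 - ξ.2, ξ.2) := by
  unfold torusFourier
  rw [Finset.mul_sum]
  refine Fintype.sum_equiv (shearRight s) _ _ fun z => ?_
  rw [mul_left_comm, ← AddChar.map_add_eq_mul]
  simp only [Function.comp, shearRight, Equiv.coe_fn_mk]
  congr 2
  ring

theorem torusFourier_comp_shearLeft (f : ZMod m × ZMod m → ℂ) (s : ZMod m) (ξ : ZMod m × ZMod m) :
    torusFourier (f ∘ shearLeft s) ξ =
      ZMod.stdAddChar (ξ.1 * s) * torusFourier f (ξ.1, ξ.2 - ξ.1) := by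
  unfold torusFourier
  rw [Finset.mul_sum]
  refine Fintype.sum_equiv (shearLeft s) _ _ fun z => ?_
  rw [mul_left_comm, ← AddChar.map_add_eq_mul]
  simp only [Function.comp, shearLeft, Equiv.coe_fn_mk]
  congr 2
  ring

theorem torusFourier_sub (f g : ZMod m × ZMod m → ℂ) (ξ : ZMod m × ZMod m) :
    torusFourier (f - g) ξ = torusFourier f ξ - torusFourier g ξ := by
  simp [torusFourier, sub_mul]

/-! ### Phases, cosine weights and wrap-around on the dual torus -/

theorem two_mul_natAbs_valMinAbs_le (a : ZMod m) : a.valMinAbs.natAbs * 2 ≤ m := by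
  have := a.valMinAbs_mem_Ioc
  rw [Set.mem_Ioc] at this
  omega

theorem norm_one_add_stdAddChar (a : ZMod m) :
    ‖1 + (ZMod.stdAddChar a : ℂ)‖ = 2 * Real.cos (Real.pi * a.valMinAbs.natAbs / m) := by
  have hm : (0 : ℝ) < m := by exact_mod_cast Nat.pos_of_ne_zero (NeZero.ne m)
  have h0 : (a.valMinAbs.natAbs : ℝ) * 2 ≤ m := by
    exact_mod_cast two_mul_natAbs_valMinAbs_le a
  have hpi := Real.pi_pos
  have hnn : 0 ≤ Real.cos (Real.pi * a.valMinAbs.natAbs / m) := by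
    apply Real.cos_nonneg_of_neg_pi_div_two_le_of_le
    · have : 0 ≤ Real.pi * a.valMinAbs.natAbs / m := by positivity
      linarith
    · rw [div_le_iff₀ hm]
      nlinarith
  rw [← sq_eq_sq₀ (norm_nonneg _) (by linarith)]
  have habs : Real.cos (Real.pi * a.valMinAbs.natAbs / m) =
      Real.cos (Real.pi * (a.valMinAbs : ℝ) / m) := by
    rw [← Real.cos_abs (Real.pi * (a.valMinAbs : ℝ) / m), abs_div, abs_mul, abs_of_pos hpi,
      Nat.abs_cast, Nat.cast_natAbs, Int.cast_abs]
  rw [habs]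
  set x := Real.pi * (a.valMinAbs : ℝ) / m with hx
  have he : (ZMod.stdAddChar a : ℂ) = Complex.exp ((2 * x : ℝ) * Complex.I) := by
    conv_lhs => rw [← ZMod.coe_valMinAbs a]
    rw [ZMod.stdAddChar_coe, hx]
    congr 1
    push_cast
    ring
  rw [he, Complex.sq_norm, Complex.normSq_apply]
  simp only [Complex.add_re, Complex.add_im, Complex.one_re, Complex.one_im,
    Complex.exp_ofReal_mul_I_re, Complex.exp_ofReal_mul_I_im, Real.cos_two_mul, Real.sin_two_mul]
  linear_combination 4 * Real.cos x ^ 2 * Real.sin_sq_add_cos_sq x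

/-- Expanding both squares leaves the single cross term `-2 Re ((1 + w) b ā)`, so the two phases
partly cancel. -/
theorem norm_sub_sq_add_norm_sub_mul_sq_ge (a b w : ℂ) (hw : ‖w‖ = 1) :
    2 * ‖a‖ ^ 2 + 2 * ‖b‖ ^ 2 - 2 * (‖a‖ * ‖b‖ * ‖1 + w‖) ≤ ‖b - a‖ ^ 2 + ‖w * b - a‖ ^ 2 := by
  have h : ((1 + w) * b * (starRingEnd ℂ) a).re ≤ ‖a‖ * ‖b‖ * ‖1 + w‖ := by
    refine (Complex.re_le_norm _).trans_eq ?_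
    rw [norm_mul, norm_mul, Complex.norm_conj]
    ring
  have h' : ((1 + w) * b * (starRingEnd ℂ) a).re =
      (b * (starRingEnd ℂ) a).re + (w * b * (starRingEnd ℂ) a).re := by
    rw [← Complex.add_re]
    ring_nf
  have hwb : Complex.normSq (w * b) = Complex.normSq b := by
    rw [Complex.normSq_mul, Complex.normSq_eq_norm_sq, hw]
    ring
  simp only [Complex.sq_norm, Complex.normSq_sub, hwb]
  linarith

/-- The lattice point of smallest coordinates representing a point of the torus. -/
def torusRep (u : ZMod m × ZMod m) : ℤ × ℤ := (u.1.valMinAbs, u.2.valMinAbs)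

/-- Half the norm of `1 + χ a` for the standard character `χ`. -/
noncomputable def cosWeight (a : ZMod m) : ℝ := Real.cos (Real.pi * a.valMinAbs.natAbs / m)

theorem cosWeight_nonneg (a : ZMod m) : 0 ≤ cosWeight a := by
  have := norm_one_add_stdAddChar a
  have h := norm_nonneg (1 + (ZMod.stdAddChar a : ℂ))
  rw [cosWeight]
  linarith

/-- By sum-to-product the sum is at most twice the cosine of the mean angle, which lies in `[π/4,
π/2]`. -/
theorem cosWeight_add_le (a b : ZMod m)
    (h : m ≤ 2 * (a.valMinAbs.natAbs + b.valMinAbs.natAbs)) :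
    cosWeight a + cosWeight b ≤ √2 := by
  have hm : (0 : ℝ) < m := by exact_mod_cast Nat.pos_of_ne_zero (NeZero.ne m)
  have ha : (a.valMinAbs.natAbs : ℝ) * 2 ≤ m := by exact_mod_cast two_mul_natAbs_valMinAbs_le a
  have hb : (b.valMinAbs.natAbs : ℝ) * 2 ≤ m := by exact_mod_cast two_mul_natAbs_valMinAbs_le b
  have h' : (m : ℝ) ≤ 2 * (a.valMinAbs.natAbs + b.valMinAbs.natAbs) := by exact_mod_cast h
  have hpi := Real.pi_pos
  rw [cosWeight, cosWeight, Real.cos_add_cos]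
  set s := (Real.pi * a.valMinAbs.natAbs / m + Real.pi * b.valMinAbs.natAbs / m) / 2 with hs
  have hs' : s = Real.pi * ((a.valMinAbs.natAbs + b.valMinAbs.natAbs) / m) / 2 := by
    rw [hs]; ring
  have hle : ((a.valMinAbs.natAbs : ℝ) + b.valMinAbs.natAbs) / m ≤ 1 := by
    rw [div_le_one hm]; linarith
  have hge : 1 / 2 ≤ ((a.valMinAbs.natAbs : ℝ) + b.valMinAbs.natAbs) / m := by
    rw [le_div_iff₀ hm]; linarith
  have h1 : Real.cos s ≤ √2 / 2 := by
    rw [← Real.cos_pi_div_four]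
    apply Real.cos_le_cos_of_nonneg_of_le_pi (by linarith) <;> rw [hs'] <;> nlinarith
  have h0 : 0 ≤ Real.cos s := by
    apply Real.cos_nonneg_of_neg_pi_div_two_le_of_le <;> rw [hs'] <;> nlinarith
  have := mul_le_mul_of_nonneg_left (Real.cos_le_one
    ((Real.pi * a.valMinAbs.natAbs / m - Real.pi * b.valMinAbs.natAbs / m) / 2))
    (show 0 ≤ 2 * Real.cos s by linarith)
  linarith

theorem valMinAbs_add_of_lt {a b : ZMod m}
    (h : 2 * (a.valMinAbs.natAbs + b.valMinAbs.natAbs) < m) :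
    (a + b).valMinAbs = a.valMinAbs + b.valMinAbs := by
  rw [ZMod.valMinAbs_spec]
  refine ⟨by simp, ?_⟩
  rw [Set.mem_Ioc]
  omega

theorem valMinAbs_sub_of_lt {a b : ZMod m}
    (h : 2 * (a.valMinAbs.natAbs + b.valMinAbs.natAbs) < m) :
    (a - b).valMinAbs = a.valMinAbs - b.valMinAbs := by
  rw [ZMod.valMinAbs_spec]
  refine ⟨by simp, ?_⟩
  rw [Set.mem_Ioc]
  omega

/-- The weight of an edge of the dual torus. -/
noncomputable def torusWeight (u v : ZMod m × ZMod m) : ℝ := edgeWeight (torusRep u) (torusRep v)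

theorem sum_torusWeight_le (u : ZMod m × ZMod m) (hu : u ≠ 0) :
    cosWeight u.2 * (torusWeight u (u.1 - u.2, u.2) + torusWeight u (u.1 + u.2, u.2)) +
      cosWeight u.1 * (torusWeight u (u.1, u.2 - u.1) + torusWeight u (u.1, u.2 + u.1)) ≤ 23 / 6 := by
  have hc1 := cosWeight_nonneg u.1
  have hc2 := cosWeight_nonneg u.2
  unfold torusWeight
  by_cases h : 2 * (u.1.valMinAbs.natAbs + u.2.valMinAbs.natAbs) < m
  · have hne : u.1.valMinAbs ≠ 0 ∨ u.2.valMinAbs ≠ 0 := by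
      rw [Ne, Ne, ZMod.valMinAbs_eq_zero, ZMod.valMinAbs_eq_zero]
      by_contra! hcon
      exact hu (Prod.ext hcon.1 hcon.2)
    have key := sum_edgeWeight_le u.1.valMinAbs u.2.valMinAbs hne
    have h' : 2 * (u.2.valMinAbs.natAbs + u.1.valMinAbs.natAbs) < m := by omega
    simp only [torusRep, valMinAbs_add_of_lt h, valMinAbs_sub_of_lt h, valMinAbs_add_of_lt h',
      valMinAbs_sub_of_lt h']
    refine le_trans (add_le_add ?_ ?_) key
    · exact mul_le_of_le_one_left (add_nonneg (edgeWeight_pos _ _).le (edgeWeight_pos _ _).le)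
        (Real.cos_le_one _)
    · exact mul_le_of_le_one_left (add_nonneg (edgeWeight_pos _ _).le (edgeWeight_pos _ _).le)
        (Real.cos_le_one _)
  -- Here the shears may wrap around, so the lattice bound is unavailable. The crude weight `4/3`
  -- suffices: `√2 · 8/3 ≤ 23/16 · 8/3 = 23/6`.
  · have hcos := cosWeight_add_le u.1 u.2 (by omega)
    have hsq : √2 ≤ 23 / 16 := by
      rw [Real.sqrt_le_iff]
      norm_num
    have hw : ∀ v w : ZMod m × ZMod m,
        edgeWeight (torusRep u) (torusRep v) + edgeWeight (torusRep u) (torusRep w) ≤ 8 / 3 := by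
      intro v w
      linarith [edgeWeight_le (torusRep u) (torusRep v), edgeWeight_le (torusRep u) (torusRep w)]
    have e1 := mul_le_mul_of_nonneg_left (hw (u.1 - u.2, u.2) (u.1 + u.2, u.2)) hc2
    have e2 := mul_le_mul_of_nonneg_left (hw (u.1, u.2 - u.1) (u.1, u.2 + u.1)) hc1
    linarith

/-- The weighted arithmetic-geometric mean inequality summed along the orbits of a permutation. -/
theorem sum_mul_comp_le {ι : Type*} [Fintype ι] (A : Equiv.Perm ι) (c g : ι → ℝ) (w : ι → ι → ℝ)
    (hc : ∀ u, 0 ≤ c u) (hcA : ∀ u, c (A u) = c u) (hw : ∀ u v, 0 < w u v)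
    (hsw : ∀ u v, w u v * w v u = 1) :
    ∑ u, c u * (2 * (g u * g (A u))) ≤ ∑ u, c u * (w u (A u) + w u (A.symm u)) * g u ^ 2 := by
  have h : ∑ u, c u * (w u (A u) + w u (A.symm u)) * g u ^ 2 =
      ∑ u, c u * (w u (A u) * g u ^ 2 + w (A u) u * g (A u) ^ 2) := by
    simp only [mul_add, add_mul, Finset.sum_add_distrib, mul_assoc]
    congr 1
    rw [← Equiv.sum_comp A]
    simp [hcA]
  rw [h]
  refine Finset.sum_le_sum fun u _ => mul_le_mul_of_nonneg_left ?_ (hc u)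
  have h1 := hw u (A u)
  have h2 := hsw u (A u)
  have : w u (A u) * (w u (A u) * g u ^ 2 + w (A u) u * g (A u) ^ 2 - 2 * (g u * g (A u))) =
      (w u (A u) * g u - g (A u)) ^ 2 := by
    linear_combination g (A u) ^ 2 * h2
  nlinarith [nonneg_of_mul_nonneg_right (this ▸ sq_nonneg _) h1]

/-- The Dirichlet form of a permutation. -/
noncomputable def permEnergy {ι : Type*} [Fintype ι] (σ : Equiv.Perm ι) (f : ι → ℂ) : ℝ :=
  ∑ z, ‖f (σ z) - f z‖ ^ 2

theorem sq_mul_permEnergy (σ : Equiv.Perm (ZMod m × ZMod m)) (f : ZMod m × ZMod m → ℂ) :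
    (m : ℝ) ^ 2 * permEnergy σ f = ∑ ξ, ‖torusFourier (f ∘ σ) ξ - torusFourier f ξ‖ ^ 2 := by
  simp only [← torusFourier_sub, sum_norm_torusFourier_sq]
  rfl

theorem sum_shear_energy_ge (A : Equiv.Perm (ZMod m × ZMod m)) (F : ZMod m × ZMod m → ℂ)
    (t : ZMod m × ZMod m → ZMod m) (ht : ∀ u, t (A u) = t u) :
    4 * ∑ ξ, ‖F ξ‖ ^ 2 - 2 * ∑ ξ, cosWeight (t ξ) *
        (torusWeight ξ (A ξ) + torusWeight ξ (A.symm ξ)) * ‖F ξ‖ ^ 2 ≤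
      ∑ ξ, ‖F (A ξ) - F ξ‖ ^ 2 + ∑ ξ, ‖ZMod.stdAddChar (t ξ) * F (A ξ) - F ξ‖ ^ 2 := by
  have h1 := sum_mul_comp_le A (fun ξ => cosWeight (t ξ)) (fun ξ => ‖F ξ‖) torusWeight
    (fun _ => cosWeight_nonneg _) (fun u => by rw [ht]) (fun _ _ => edgeWeight_pos _ _)
    (fun _ _ => edgeWeight_mul_swap _ _)
  have h2 : 4 * ∑ ξ, ‖F ξ‖ ^ 2 = ∑ ξ, (2 * ‖F ξ‖ ^ 2 + 2 * ‖F (A ξ)‖ ^ 2) := by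
    rw [Finset.sum_add_distrib, ← Finset.mul_sum, ← Finset.mul_sum,
      Equiv.sum_comp A fun ξ => ‖F ξ‖ ^ 2]
    ring
  rw [← Finset.sum_add_distrib, h2]
  refine (sub_le_sub_left (mul_le_mul_of_nonneg_left h1 zero_le_two) _).trans ?_
  rw [Finset.mul_sum, ← Finset.sum_sub_distrib]
  refine Finset.sum_le_sum fun ξ _ => ?_
  have := norm_sub_sq_add_norm_sub_mul_sq_ge (F ξ) (F (A ξ)) (ZMod.stdAddChar (t ξ))
    (AddChar.norm_apply _ _)
  rw [norm_one_add_stdAddChar] at this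
  rw [cosWeight]
  linarith

/-- The spectral gap of the Gabber–Galil permutations. -/
theorem gabberGalil_gap (f : ZMod m × ZMod m → ℂ) (hf : ∑ z, f z = 0) :
    1 / 3 * ∑ z, ‖f z‖ ^ 2 ≤ permEnergy (shearRight 0) f + permEnergy (shearRight 1) f +
      (permEnergy (shearLeft 0) f + permEnergy (shearLeft 1) f) := by
  have hm : (0 : ℝ) < (m : ℝ) ^ 2 := by
    have : (0 : ℝ) < m := by exact_mod_cast Nat.pos_of_ne_zero (NeZero.ne m)
    positivity
  refine le_of_mul_le_mul_left ?_ hm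
  rw [mul_left_comm, ← sum_norm_torusFourier_sq]
  simp only [mul_add, sq_mul_permEnergy, torusFourier_comp_shearRight,
    torusFourier_comp_shearLeft, mul_zero, AddChar.map_zero_eq_one, one_mul, mul_one]
  set F := torusFourier f with hF
  have hF0 : F 0 = 0 := by simp [hF, torusFourier, hf]
  let A : Equiv.Perm (ZMod m × ZMod m) :=
    ⟨fun u => (u.1 - u.2, u.2), fun u => (u.1 + u.2, u.2), fun u => by simp, fun u => by simp⟩
  let B : Equiv.Perm (ZMod m × ZMod m) :=
    ⟨fun u => (u.1, u.2 - u.1), fun u => (u.1, u.2 + u.1), fun u => by simp, fun u => by simp⟩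
  have hA := sum_shear_energy_ge A F (fun u => u.2) (fun u => rfl)
  have hB := sum_shear_energy_ge B F (fun u => u.1) (fun u => rfl)
  have hW : ∑ ξ, cosWeight ξ.2 * (torusWeight ξ (A ξ) + torusWeight ξ (A.symm ξ)) * ‖F ξ‖ ^ 2 +
      ∑ ξ, cosWeight ξ.1 * (torusWeight ξ (B ξ) + torusWeight ξ (B.symm ξ)) * ‖F ξ‖ ^ 2 ≤
      23 / 6 * ∑ ξ, ‖F ξ‖ ^ 2 := by
    rw [← Finset.sum_add_distrib, Finset.mul_sum]
    refine Finset.sum_le_sum fun ξ _ => ?_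
    rw [← add_mul]
    rcases eq_or_ne ξ 0 with rfl | hξ
    · simp [hF0]
    · exact mul_le_mul_of_nonneg_right (sum_torusWeight_le ξ hξ) (sq_nonneg _)
  -- The two shear directions give `8 - 2 · 23/6 = 1/3`.
  refine le_trans ?_ (add_le_add hA hB)
  linarith

end Torus

/-! ### Vertex expansion of the Gabber–Galil graph -/

/-- A permutation moves as many points into `Y` as out of it, hence the factor `2`. -/
theorem permEnergy_indicator {ι : Type*} [Fintype ι] [DecidableEq ι] (σ : Equiv.Perm ι)
    (Y : Finset ι) (c : ℂ) :
    permEnergy σ (fun z => (if z ∈ Y then 1 else 0) - c) = 2 * (Y.filter fun z => σ z ∉ Y).card := by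
  have h : ∀ z, ‖((if σ z ∈ Y then 1 else 0) - c) - ((if z ∈ Y then 1 else 0) - c)‖ ^ 2 =
      (if σ z ∈ Y then (1 : ℝ) else 0) - (if z ∈ Y then 1 else 0) +
        2 * (if z ∈ Y ∧ σ z ∉ Y then 1 else 0) := by
    intro z
    rw [sub_sub_sub_cancel_right]
    by_cases h1 : σ z ∈ Y <;> by_cases h2 : z ∈ Y <;> simp [h1, h2]
    norm_num
  rw [permEnergy, Finset.sum_congr rfl fun z _ => h z, Finset.sum_add_distrib,
    Finset.sum_sub_distrib, Equiv.sum_comp σ fun z => if z ∈ Y then (1 : ℝ) else 0, sub_self,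
    zero_add, ← Finset.mul_sum, Finset.sum_boole]
  congr 3
  ext z
  simp

theorem card_filter_perm_notMem_le {ι : Type*} [DecidableEq ι] (σ : Equiv.Perm ι)
    {Y Z : Finset ι} (hYZ : Y ⊆ Z) (hσ : ∀ z ∈ Y, σ z ∈ Z) :
    Y.card + (Y.filter fun z => σ z ∉ Y).card ≤ Z.card := by
  rw [← Finset.card_map (s := Y.filter fun z => σ z ∉ Y) σ.toEmbedding, ← Finset.card_union_of_disjoint]
  · apply Finset.card_le_card
    intro z hz
    rw [Finset.mem_union, Finset.mem_map] at hz
    rcases hz with hz | ⟨w, hw, rfl⟩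
    · exact hYZ hz
    · exact hσ w (Finset.mem_filter.1 hw).1
  · rw [Finset.disjoint_left]
    intro z hz hz'
    obtain ⟨w, hw, rfl⟩ := Finset.mem_map.1 hz'
    exact (Finset.mem_filter.1 hw).2 hz

/-- Apply the gap to the centred indicator of `Y`, whose squared norm is `|Y|(1 - |Y|/m²)`. Each of
the four energies is at most `2(|Z| - |Y|)`, so `1/3` becomes `1/24`. -/
theorem torus_expansion {m : ℕ} [NeZero m] {Y Z : Finset (ZMod m × ZMod m)} (hYZ : Y ⊆ Z)
    (hR : ∀ s : ZMod m, s = 0 ∨ s = 1 → ∀ z ∈ Y, shearRight s z ∈ Z)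
    (hL : ∀ s : ZMod m, s = 0 ∨ s = 1 → ∀ z ∈ Y, shearLeft s z ∈ Z) :
    (Y.card : ℝ) + 1 / 24 * (Y.card * (1 - Y.card / (m : ℝ) ^ 2)) ≤ Z.card := by
  have hm : (0 : ℝ) < (m : ℝ) ^ 2 := by
    have : (0 : ℝ) < m := by exact_mod_cast Nat.pos_of_ne_zero (NeZero.ne m)
    positivity
  have hmC : (m : ℂ) ≠ 0 := by exact_mod_cast NeZero.ne m
  set α : ℝ := Y.card / (m : ℝ) ^ 2 with hα
  have hcard : (Fintype.card (ZMod m × ZMod m) : ℝ) = (m : ℝ) ^ 2 := by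
    simp [ZMod.card, sq]
  have hsum : ∑ z : ZMod m × ZMod m, ((if z ∈ Y then (1 : ℂ) else 0) - (α : ℂ)) = 0 := by
    rw [Finset.sum_sub_distrib]
    simp [hα, ZMod.card]
    field_simp
    simp
  have hnorm : ∑ z : ZMod m × ZMod m, ‖(if z ∈ Y then (1 : ℂ) else 0) - (α : ℂ)‖ ^ 2 =
      Y.card * (1 - α) := by
    have h : ∀ z : ZMod m × ZMod m, ‖(if z ∈ Y then (1 : ℂ) else 0) - (α : ℂ)‖ ^ 2 =
        (1 - 2 * α) * (if z ∈ Y then (1 : ℝ) else 0) + α ^ 2 := by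
      intro z
      have : (if z ∈ Y then (1 : ℂ) else 0) - (α : ℂ) =
          (((if z ∈ Y then (1 : ℝ) else 0) - α : ℝ) : ℂ) := by
        push_cast
        split_ifs <;> simp
      rw [this, Complex.norm_real, Real.norm_eq_abs, sq_abs]
      split_ifs <;> ring
    rw [Finset.sum_congr rfl fun z _ => h z, Finset.sum_add_distrib, ← Finset.mul_sum,
      Finset.sum_boole, Finset.sum_const, Finset.card_univ, nsmul_eq_mul, hcard,
      Finset.filter_univ_mem, hα]
    field_simp
    ring
  have key := gabberGalil_gap _ hsum
  rw [hnorm] at key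
  simp only [permEnergy_indicator] at key
  have b1 := card_filter_perm_notMem_le _ hYZ (hR 0 (Or.inl rfl))
  have b2 := card_filter_perm_notMem_le _ hYZ (hR 1 (Or.inr rfl))
  have b3 := card_filter_perm_notMem_le _ hYZ (hL 0 (Or.inl rfl))
  have b4 := card_filter_perm_notMem_le _ hYZ (hL 1 (Or.inr rfl))
  rify at b1 b2 b3 b4
  linarith

/-- The point of the torus with number `j`. -/
def torusPoint (m j : ℕ) : ZMod m × ZMod m := (((j - 1) / m : ℕ), ((j - 1) % m : ℕ))

theorem torusPoint_pairToInt {m x y : ℕ} (hy : y < m) :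
    torusPoint m (pairToInt m (x, y)) = ((x : ZMod m), (y : ZMod m)) := by
  have h1 : (x * m + y) / m = x := by
    rw [mul_comm, Nat.mul_add_div (by omega), Nat.div_eq_of_lt hy, add_zero]
  have h2 : (x * m + y) % m = y := by
    rw [mul_comm, Nat.mul_add_mod, Nat.mod_eq_of_lt hy]
  simp only [torusPoint, pairToInt, Nat.add_sub_cancel, h1, h2]

theorem torusPoint_injOn (m : ℕ) : Set.InjOn (torusPoint m) (Finset.Icc 1 (m ^ 2) : Finset ℕ) := by
  intro a ha b hb h
  rw [Finset.coe_Icc, Set.mem_Icc] at ha hb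
  have hm : 0 < m := by
    rcases Nat.eq_zero_or_pos m with rfl | hm
    · omega
    · exact hm
  simp only [torusPoint, Prod.mk.injEq, ZMod.natCast_eq_natCast_iff'] at h
  have hlt : ∀ c, 1 ≤ c ∧ c ≤ m ^ 2 → (c - 1) / m < m := by
    intro c hc
    rw [Nat.div_lt_iff_lt_mul hm, ← sq]
    omega
  rw [Nat.mod_eq_of_lt (hlt a ha), Nat.mod_eq_of_lt (hlt b hb), Nat.mod_mod, Nat.mod_mod] at h
  have e1 := Nat.div_add_mod (a - 1) m
  have e2 := Nat.div_add_mod (b - 1) m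
  rw [h.1, h.2] at e1
  omega

theorem getParentsGG_subset {m j : ℕ} (hj : j ∈ Finset.Icc 1 (m ^ 2)) :
    getParentsGG m j ⊆ Finset.Icc 1 (m ^ 2) := by
  rw [Finset.mem_Icc] at hj
  have hm : 0 < m := by
    rcases Nat.eq_zero_or_pos m with rfl | hm
    · omega
    · exact hm
  have hx : (j - 1) / m < m := by
    rw [Nat.div_lt_iff_lt_mul hm, ← sq]
    omega
  have hp : ∀ p : ℕ × ℕ, p.1 < m → p.2 < m → pairToInt m p ∈ Finset.Icc 1 (m ^ 2) := by
    intro p h1 h2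
    rw [Finset.mem_Icc, pairToInt]
    refine ⟨by omega, ?_⟩
    nlinarith
  intro z hz
  simp only [getParentsGG, Finset.mem_image, Finset.mem_univ, true_and] at hz
  obtain ⟨k, rfl⟩ := hz
  apply hp <;> fin_cases k <;> simp only [sigma, intToPair] <;>
    first | exact hx | exact Nat.mod_lt _ hm

theorem gabberGalil_expansion {m : ℕ} (hm : 0 < m) {Y : Finset ℕ} (hY : Y ⊆ Finset.Icc 1 (m ^ 2)) :
    (Y.card : ℝ) + 1 / 24 * (Y.card * (1 - Y.card / (m : ℝ) ^ 2)) ≤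
      (Y.biUnion (getParentsGG m)).card := by
  have : NeZero m := ⟨hm.ne'⟩
  have himg : ∀ k : Fin 5, ∀ j ∈ Y, torusPoint m (pairToInt m (sigma m k (intToPair m j))) ∈
      (Y.biUnion (getParentsGG m)).image (torusPoint m) := by
    intro k j hj
    refine Finset.mem_image_of_mem _ (Finset.mem_biUnion.2 ⟨j, hj, ?_⟩)
    exact Finset.mem_image_of_mem _ (Finset.mem_univ k)
  have hlt : ∀ a, a % m < m := fun a => Nat.mod_lt _ hm
  have key := torus_expansion (Y := Y.image (torusPoint m))
    (Z := (Y.biUnion (getParentsGG m)).image (torusPoint m)) ?_ ?_ ?_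
  · rw [Finset.card_image_of_injOn ((torusPoint_injOn m).mono (by exact_mod_cast hY)),
      Finset.card_image_of_injOn ((torusPoint_injOn m).mono ?_)] at key
    · exact key
    · have : Y.biUnion (getParentsGG m) ⊆ Finset.Icc 1 (m ^ 2) :=
        Finset.biUnion_subset.2 fun j hj => getParentsGG_subset (hY hj)
      exact_mod_cast this
  · intro z hz
    obtain ⟨j, hj, rfl⟩ := Finset.mem_image.1 hz
    convert himg 0 j hj using 1
    rw [sigma, intToPair, torusPoint_pairToInt (hlt _), torusPoint]
  · rintro s (rfl | rfl) z hz <;> obtain ⟨j, hj, rfl⟩ := Finset.mem_image.1 hz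
    · convert himg 1 j hj using 1
      rw [sigma, intToPair, torusPoint_pairToInt (hlt _)]
      simp [torusPoint, shearRight]
    · convert himg 2 j hj using 1
      rw [sigma, intToPair, torusPoint_pairToInt (hlt _)]
      simp [torusPoint, shearRight]
  · rintro s (rfl | rfl) z hz <;> obtain ⟨j, hj, rfl⟩ := Finset.mem_image.1 hz
    · convert himg 3 j hj using 1
      rw [sigma, intToPair, torusPoint_pairToInt (hlt _)]
      simp [torusPoint, shearLeft]
    · convert himg 4 j hj using 1
      rw [sigma, intToPair, torusPoint_pairToInt (hlt _)]
      simp [torusPoint, shearLeft]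

/-! ### Iterated expansion -/

/-- Expansion restated for the odds `y / (m² - y)`, which grow by a fixed factor and hence iterate
cleanly. Cross-multiplying avoids dividing by zero. -/
theorem card_biUnion_getParentsGG_odds {m : ℕ} (hm : 0 < m) {Y : Finset ℕ}
    (hY : Y ⊆ Finset.Icc 1 (m ^ 2)) :
    (1 + 1 / 24) * (Y.card * ((m : ℝ) ^ 2 - (Y.biUnion (getParentsGG m)).card)) ≤
      (Y.biUnion (getParentsGG m)).card * ((m : ℝ) ^ 2 - Y.card) := by
  have h := gabberGalil_expansion hm hY
  have hM : (0 : ℝ) < (m : ℝ) ^ 2 := by positivity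
  have hy : (Y.card : ℝ) ≤ (m : ℝ) ^ 2 := by
    have := Finset.card_le_card hY
    rw [Nat.card_Icc, Nat.add_sub_cancel] at this
    exact_mod_cast this
  set y : ℝ := (Y.card : ℝ)
  set y' : ℝ := ((Y.biUnion (getParentsGG m)).card : ℝ)
  set M : ℝ := (m : ℝ) ^ 2
  have hy0 : 0 ≤ y := Nat.cast_nonneg _
  obtain ⟨d, hd⟩ : ∃ d, d = 1 / 24 * (y * (1 - y / M)) := ⟨_, rfl⟩
  have hdM : d * M = 1 / 24 * (y * (M - y)) := by
    rw [hd]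
    field_simp
  have hd0 : 0 ≤ d := by
    rw [hd]
    have : y / M ≤ 1 := (div_le_one hM).2 hy
    have : 0 ≤ 1 - y / M := by linarith
    positivity
  rw [← hd] at h
  nlinarith [mul_nonneg hy0 hd0, mul_nonneg hy0 (sub_nonneg.2 h),
    mul_nonneg (sub_nonneg.2 hy) (sub_nonneg.2 h)]

theorem layered_expansion {m : ℕ} (hm : 0 < m) (i : ℕ) {Y : Finset ℕ}
    (hY : Y ⊆ Finset.Icc 1 (m ^ 2)) :
    Y.biUnion (getParentsLayered i m) ⊆ Finset.Icc 1 (m ^ 2) ∧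
    (1 + 1 / 24) ^ i * (Y.card * ((m : ℝ) ^ 2 - (Y.biUnion (getParentsLayered i m)).card)) ≤
      (Y.biUnion (getParentsLayered i m)).card * ((m : ℝ) ^ 2 - Y.card) := by
  induction i generalizing Y with
  | zero =>
    have : Y.biUnion (getParentsLayered 0 m) = Y := by
      ext z
      simp [getParentsLayered]
    rw [this]
    exact ⟨hY, by simp⟩
  | succ i ih =>
    have hZ : Y.biUnion (getParentsGG m) ⊆ Finset.Icc 1 (m ^ 2) :=
      Finset.biUnion_subset.2 fun j hj => getParentsGG_subset (hY hj)
    have heq : Y.biUnion (getParentsLayered (i + 1) m) =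
        (Y.biUnion (getParentsGG m)).biUnion (getParentsLayered i m) := by
      rw [Finset.biUnion_biUnion]
      rfl
    obtain ⟨h1, h2⟩ := ih hZ
    have h3 := card_biUnion_getParentsGG_odds hm hY
    have h4 := gabberGalil_expansion hm hY
    rw [heq]
    refine ⟨h1, ?_⟩
    have hcard : ∀ {W : Finset ℕ}, W ⊆ Finset.Icc 1 (m ^ 2) → (W.card : ℝ) ≤ (m : ℝ) ^ 2 := by
      intro W hW
      have := Finset.card_le_card hW
      rw [Nat.card_Icc, Nat.add_sub_cancel] at this
      exact_mod_cast this
    have hM : (0 : ℝ) < (m : ℝ) ^ 2 := by positivity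
    have l0 := hcard hY
    have l1 := hcard hZ
    have l2 := hcard h1
    have p0 : (0 : ℝ) ≤ Y.card := Nat.cast_nonneg _
    set y : ℝ := (Y.card : ℝ)
    set y1 : ℝ := ((Y.biUnion (getParentsGG m)).card : ℝ)
    set y2 : ℝ := (((Y.biUnion (getParentsGG m)).biUnion (getParentsLayered i m)).card : ℝ)
    set M : ℝ := (m : ℝ) ^ 2
    have p2 : (0 : ℝ) ≤ y2 := Nat.cast_nonneg _
    have hyy1 : y ≤ y1 := by
      have : y / M ≤ 1 := (div_le_one hM).2 l0
      have : 0 ≤ 1 / 24 * (y * (1 - y / M)) := by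
        have : 0 ≤ 1 - y / M := by linarith
        positivity
      linarith
    rcases p0.eq_or_lt with hy | hy
    · rw [← hy]
      simp only [zero_mul, mul_zero]
      exact mul_nonneg p2 (by linarith)
    have hy1 : 0 < y1 := hy.trans_le hyy1
    have hpow : (0 : ℝ) < (1 + 1 / 24) ^ i := by positivity
    -- Chaining the two inequalities cancels `M - y1`, so a full intermediate layer is treated
    -- separately.
    rcases l1.eq_or_lt with hl1 | hl1
    · have : M ≤ y2 := by
        rw [hl1, sub_self, mul_zero] at h2
        by_contra! hcon
        have : 0 < (1 + 1 / 24) ^ i * (M * (M - y2)) :=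
          mul_pos hpow (mul_pos hM (by linarith))
        linarith
      have e : M - y2 = 0 := by linarith
      rw [e, mul_zero, mul_zero]
      exact mul_nonneg p2 (by linarith)
    · refine le_of_mul_le_mul_right ?_ (mul_pos hy1 (sub_pos.2 hl1))
      have hq := mul_le_mul h2 h3 (by
        refine mul_nonneg (by norm_num) (mul_nonneg p0 (by linarith))) (mul_nonneg p2 (by linarith))
      calc _ = (1 + 1 / 24) ^ i * (y1 * (M - y2)) * ((1 + 1 / 24) * (y * (M - y1))) := by ring
        _ ≤ _ := hq
        _ = _ := by ring

/-! ### The truncated layered graphs are expanders -/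

theorem gabberGalilConst_pos : 0 < gabberGalilConst := by
  have : √3 < 2 := by
    rw [Real.sqrt_lt' (by norm_num)]
    norm_num
  rw [gabberGalilConst]
  linarith

theorem gabberGalilConst_le : gabberGalilConst ≤ 1 / 4 := by
  have : 1 ≤ √3 := by
    rw [Real.one_le_sqrt]
    norm_num
  rw [gabberGalilConst]
  linarith

/-- The extra layer makes the bound strict. The sharp Gabber–Galil constant is not needed: `(1 +
d₀η)² ≤ 25/24` for `η < 1/40`, and this square yields the squared odds. -/
theorem odds_sq_lt_pow_numLayers {η : ℝ} (h0 : 0 < η) (h1 : η < 1 / 40) :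
    ((1 - η) / η) ^ 2 < (1 + 1 / 24) ^ numLayers η := by
  have hd := gabberGalilConst_pos
  have hd' := gabberGalilConst_le
  have hodds : 0 < (1 - η) / η := div_pos (by linarith) h0
  have hb : 1 < 1 + gabberGalilConst * η := by nlinarith
  have hlog : 0 < Real.log (1 + gabberGalilConst * η) := Real.log_pos hb
  have hL : Real.log ((1 - η) / η) / Real.log (1 + gabberGalilConst * η) < numLayers η := by
    rw [numLayers]
    push_cast
    linarith [Nat.le_ceil (Real.log ((1 - η) / η) / Real.log (1 + gabberGalilConst * η))]
  rw [div_lt_iff₀ hlog, ← Real.log_pow, Real.log_lt_log_iff hodds (by positivity)] at hL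
  calc ((1 - η) / η) ^ 2 < ((1 + gabberGalilConst * η) ^ numLayers η) ^ 2 :=
        pow_lt_pow_left₀ hL hodds.le two_ne_zero
    _ = ((1 + gabberGalilConst * η) ^ 2) ^ numLayers η := by rw [← pow_mul, ← pow_mul, mul_comm 2]
    _ ≤ _ := by
        refine pow_le_pow_left₀ (sq_nonneg _) ?_ _
        nlinarith [mul_le_mul hd' h1.le h0.le (by norm_num : (0 : ℝ) ≤ 1 / 4)]

/-- The odds of `Y` start at `η/(1-η)` or more, so multiplying by more than their inverse square
gives more than `(1-η)m²` parents, too many to miss `X`. -/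
theorem exists_mem_getParentsLayered {m : ℕ} (hm : 0 < m) {η : ℝ} (h0 : 0 < η) (h1 : η < 1 / 40)
    {X Y : Finset ℕ} (hX : X ⊆ Finset.Icc 1 (m ^ 2)) (hY : Y ⊆ Finset.Icc 1 (m ^ 2))
    (hXc : η * (m : ℝ) ^ 2 ≤ X.card) (hYc : η * (m : ℝ) ^ 2 ≤ Y.card) :
    ∃ x ∈ X, ∃ y ∈ Y, x ∈ getParentsLayered (numLayers η) m y := by
  obtain ⟨hsub, hexp⟩ := layered_expansion hm (numLayers η) hY
  set P := Y.biUnion (getParentsLayered (numLayers η) m) with hP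
  have hM : (0 : ℝ) < (m : ℝ) ^ 2 := by positivity
  have hcard : (P.card : ℝ) ≤ (m : ℝ) ^ 2 := by
    have := Finset.card_le_card hsub
    rw [Nat.card_Icc, Nat.add_sub_cancel] at this
    exact_mod_cast this
  have hlarge : (1 - η) * (m : ℝ) ^ 2 < P.card := by
    by_contra! hcon
    have hodds := odds_sq_lt_pow_numLayers h0 h1
    rw [div_pow, div_lt_iff₀ (by positivity)] at hodds
    set M : ℝ := (m : ℝ) ^ 2
    set C : ℝ := (1 + 1 / 24) ^ numLayers η
    set p : ℝ := (P.card : ℝ)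
    set y : ℝ := (Y.card : ℝ)
    have hC : 0 < C := by positivity
    have hη : η * M ≤ M - p := by linarith
    have hηM : 0 < η * M := mul_pos h0 hM
    have e1 : C * (η * M * (η * M)) ≤ C * (y * (M - p)) :=
      mul_le_mul_of_nonneg_left (mul_le_mul hYc hη hηM.le (hηM.le.trans hYc)) hC.le
    have e2 : p * (M - y) ≤ ((1 - η) * M) * ((1 - η) * M) := by
      have hp : 0 ≤ p := Nat.cast_nonneg _
      have h1η : 0 ≤ (1 - η) * M := mul_nonneg (by linarith) hM.le
      exact (mul_le_mul_of_nonneg_left (by linarith) hp).trans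
        (mul_le_mul_of_nonneg_right hcon h1η)
    have e3 := mul_lt_mul_of_pos_right hodds (mul_pos hM hM)
    nlinarith
  have hinter : ¬ Disjoint X P := by
    intro hdis
    have := Finset.card_le_card (Finset.union_subset hX hsub)
    rw [Finset.card_union_of_disjoint hdis, Nat.card_Icc, Nat.add_sub_cancel] at this
    rify at this
    linarith
  obtain ⟨x, hx, hxP⟩ := Finset.not_disjoint_iff.1 hinter
  obtain ⟨y, hy, hxy⟩ := Finset.mem_biUnion.1 hxP
  exact ⟨x, hx, y, hy, hxy⟩

/-! ### Truncation from `m ^ 2` to `2 ^ t` nodes -/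

theorem ceilSqrt_spec (N : ℕ) : 0 < ceilSqrt N ∧ N ≤ ceilSqrt N ^ 2 :=
  Nat.sInf_mem (s := {m : ℕ | 0 < m ∧ N ≤ m ^ 2}) ⟨N + 1, by simp, by nlinarith⟩

theorem ceilSqrt_sq_le (t : ℕ) : ceilSqrt (2 ^ t) ^ 2 ≤ 2 * 2 ^ t := by
  have h : ceilSqrt (2 ^ t) ≤ 2 ^ ((t + 1) / 2) := by
    refine Nat.sInf_le ⟨by positivity, ?_⟩
    rw [← pow_mul]
    exact Nat.pow_le_pow_right two_pos (by omega)
  calc ceilSqrt (2 ^ t) ^ 2 ≤ (2 ^ ((t + 1) / 2)) ^ 2 := Nat.pow_le_pow_left h 2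
    _ = 2 ^ ((t + 1) / 2 * 2) := by rw [← pow_mul]
    _ ≤ 2 ^ (t + 1) := Nat.pow_le_pow_right two_pos (by omega)
    _ = _ := by ring

/-- Since `m² ≤ 2 · 2^t`, density `δ` in `[2^t]` is density at least `δ/2` in `[m²]`, the parameter
of the layered graph. -/
theorem exists_mem_getParentsBE {t : ℕ} {δ : ℝ} (h0 : 0 < δ) (h1 : δ < 1 / 20) {X Y : Finset ℕ}
    (hX : X ⊆ Finset.Icc 1 (2 ^ t)) (hY : Y ⊆ Finset.Icc 1 (2 ^ t))
    (hXc : δ * 2 ^ t ≤ X.card) (hYc : δ * 2 ^ t ≤ Y.card) :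
    ∃ x ∈ X, ∃ y ∈ Y, x ∈ getParentsBE (2 ^ t) δ y := by
  obtain ⟨hpos, hge⟩ := ceilSqrt_spec (2 ^ t)
  have hle : ((ceilSqrt (2 ^ t) : ℝ)) ^ 2 ≤ 2 * 2 ^ t := by exact_mod_cast ceilSqrt_sq_le t
  have hsub := Finset.Icc_subset_Icc_right (a := 1) hge
  obtain ⟨x, hx, y, hy, h⟩ := exists_mem_getParentsLayered hpos (η := δ / 2) (by linarith)
    (by linarith) (hX.trans hsub) (hY.trans hsub) (by nlinarith) (by nlinarith)
  exact ⟨x, hx, y, hy, Finset.mem_inter.2 ⟨hX hx, h⟩⟩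

/-! ### `G(δ, N)` is a local expander -/

/-- Sources are grouped by `(x - 1) / 2^t` but targets by `y / 2^t`, because expander labels start
at `1` and the target label is `y % 2^t + 1`. -/
theorem exists_edge_of_blocks {δ : ℝ} (h0 : 0 < δ) (h1 : δ < 1 / 4) {N t i j : ℕ} (ht : 1 ≤ t)
    (hji : j < i) (hij : i ≤ j + 10) {X Y : Finset ℕ} (hXN : X ⊆ Finset.Icc 1 N)
    (hX : ∀ x ∈ X, (x - 1) / 2 ^ t = j) (hY : ∀ y ∈ Y, y / 2 ^ t = i)
    (hXc : δ / 5 * 2 ^ t ≤ X.card) (hYc : δ / 5 * 2 ^ t ≤ Y.card) :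
    ∃ x ∈ X, ∃ y ∈ Y, x ∈ getParentsEGS δ y N := by
  have hq : 0 < 2 ^ t := by positivity
  have hX1 : ∀ x ∈ X, j * 2 ^ t + ((x - 1) % 2 ^ t + 1) = x := by
    intro x hx
    have := Nat.div_add_mod (x - 1) (2 ^ t)
    rw [hX x hx, mul_comm] at this
    have := (Finset.mem_Icc.1 (hXN hx)).1
    omega
  have hY1 : ∀ y ∈ Y, i * 2 ^ t + y % 2 ^ t = y := by
    intro y hy
    have := Nat.div_add_mod y (2 ^ t)
    rwa [hY y hy, mul_comm] at this
  have hXinj : Set.InjOn (fun x => (x - 1) % 2 ^ t + 1) X := by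
    intro a ha b hb hab
    rw [← hX1 a ha, ← hX1 b hb]
    simp only at hab
    rw [hab]
  have hYinj : Set.InjOn (fun y => y % 2 ^ t + 1) Y := by
    intro a ha b hb hab
    rw [← hY1 a ha, ← hY1 b hb]
    simp only at hab
    omega
  have hmod : ∀ a, a % 2 ^ t + 1 ∈ Finset.Icc 1 (2 ^ t) := by
    intro a
    rw [Finset.mem_Icc]
    have := Nat.mod_lt a hq
    omega
  obtain ⟨x', hx', y', hy', h⟩ := exists_mem_getParentsBE (t := t) (δ := δ / 5) (by linarith)
    (by linarith) (X := X.image fun x => (x - 1) % 2 ^ t + 1) (Y := Y.image fun y => y % 2 ^ t + 1)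
    (Finset.image_subset_iff.2 fun x _ => hmod _) (Finset.image_subset_iff.2 fun x _ => hmod _)
    (by rwa [Finset.card_image_of_injOn hXinj]) (by rwa [Finset.card_image_of_injOn hYinj])
  obtain ⟨x, hx, rfl⟩ := Finset.mem_image.1 hx'
  obtain ⟨y, hy, rfl⟩ := Finset.mem_image.1 hy'
  refine ⟨x, hx, y, hy, Finset.mem_inter.2 ⟨Finset.mem_union_right _ ?_, hXN hx⟩⟩
  have hty : t ≤ Nat.clog 2 y := by
    have h2 : 2 ^ t ≤ y := by
      have := hY1 y hy
      have : 1 * 2 ^ t ≤ i * 2 ^ t := Nat.mul_le_mul_right _ (by omega)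
      omega
    simpa using Nat.clog_mono_right 2 h2
  refine Finset.mem_biUnion.2 ⟨t, Finset.mem_Icc.2 ⟨ht, hty⟩, Finset.mem_biUnion.2 ⟨_, h, ?_⟩⟩
  refine Finset.mem_image.2 ⟨i - j, ?_, ?_⟩
  · rw [Finset.mem_Icc, hY y hy]
    omega
  · rw [hY y hy, Nat.sub_sub_self hji.le]
    exact hX1 x hx

/-- An interval of length at most `K * q` meets at most `K + 1` blocks of length `q`; pigeonhole. -/
theorem exists_block {p l q K : ℕ} (s : ℕ) (hq : 0 < q) (hl : l ≤ K * q) {Z : Finset ℕ}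
    (hZ : Z ⊆ Finset.Ico p (p + l)) {b : ℝ} (hb : (K + 1) * b ≤ Z.card) :
    ∃ j, b ≤ (Z.filter fun z => (z - s) / q = j).card := by
  have hmaps : ∀ z ∈ Z, (z - s) / q ∈ Finset.Icc ((p - s) / q) ((p - s) / q + K) := by
    intro z hz
    have := Finset.mem_Ico.1 (hZ hz)
    rw [Finset.mem_Icc, ← Nat.add_mul_div_right _ _ hq]
    exact ⟨Nat.div_le_div_right (by omega), Nat.div_le_div_right (by omega)⟩
  obtain ⟨j, -, hj⟩ := Finset.exists_le_card_fiber_of_nsmul_le_card_of_maps_to (b := b) hmaps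
    ⟨_, Finset.left_mem_Icc.2 (Nat.le_add_right _ _)⟩ (by
      rw [Nat.card_Icc, nsmul_eq_mul, show (p - s) / q + K + 1 - (p - s) / q = K + 1 by omega]
      push_cast
      exact hb)
  exact ⟨j, hj⟩

theorem exists_edge_of_intervals {δ : ℝ} (h0 : 0 < δ) (h1 : δ < 1 / 4) {N t : ℕ} (ht : 1 ≤ t)
    {p l K p' l' K' : ℕ} (hl : l ≤ K * 2 ^ t) (hl' : l' ≤ K' * 2 ^ t) {X Y : Finset ℕ}
    (hXN : X ⊆ Finset.Icc 1 N) (hX : X ⊆ Finset.Ico p (p + l)) (hY : Y ⊆ Finset.Ico p' (p' + l'))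
    (hXc : (K + 1) * (δ / 5 * 2 ^ t) ≤ X.card) (hYc : (K' + 1) * (δ / 5 * 2 ^ t) ≤ Y.card)
    (hlow : ∀ x ∈ X, ∀ y ∈ Y, x + 2 ^ t ≤ y) (hhigh : ∀ x ∈ X, ∀ y ∈ Y, y < x + 8 * 2 ^ t) :
    ∃ x ∈ X, ∃ y ∈ Y, x ∈ getParentsEGS δ y N := by
  have hq : 0 < 2 ^ t := by positivity
  obtain ⟨j, hj⟩ := exists_block 1 hq hl hX hXc
  obtain ⟨i, hi⟩ := exists_block 0 hq hl' hY hYc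
  have hpos : 0 < δ / 5 * 2 ^ t := by positivity
  obtain ⟨x, hx⟩ := Finset.card_pos.1 (Nat.cast_pos.1 (hpos.trans_le hj))
  obtain ⟨y, hy⟩ := Finset.card_pos.1 (Nat.cast_pos.1 (hpos.trans_le hi))
  rw [Finset.mem_filter] at hx hy
  have hxN := (Finset.mem_Icc.1 (hXN hx.1)).1
  have a1 := hlow x hx.1 y hy.1
  have a2 := hhigh x hx.1 y hy.1
  have hji : j < i := by
    rw [← hx.2, ← hy.2, Nat.lt_iff_add_one_le, ← Nat.add_div_right _ hq]
    exact Nat.div_le_div_right (by omega)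
  have hij : i ≤ j + 10 := by
    rw [← hx.2, ← hy.2, ← Nat.add_mul_div_right _ _ hq]
    exact Nat.div_le_div_right (by omega)
  obtain ⟨x, hx, y, hy, h⟩ := exists_edge_of_blocks h0 h1 ht hji hij
    ((Finset.filter_subset _ _).trans hXN) (fun x hx => (Finset.mem_filter.1 hx).2)
    (fun y hy => (Finset.mem_filter.1 hy).2) hj hi
  exact ⟨x, (Finset.mem_filter.1 hx).1, y, (Finset.mem_filter.1 hy).1, h⟩

/-- Between large subsets of two adjacent intervals there is an edge of `G(δ, N)`. -/
theorem egs_local_expander {δ : ℝ} (h0 : 0 < δ) (h1 : δ < 1 / 4) {n N : ℕ} (hN : N = 2 ^ n)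
    {a r : ℕ} (hr : 0 < r) {X Y : Finset ℕ} (hXN : X ⊆ Finset.Icc 1 N) (hYN : Y ⊆ Finset.Icc 1 N)
    (hX : X ⊆ Finset.Ico a (a + r)) (hY : Y ⊆ Finset.Ico (a + r) (a + 2 * r))
    (hXc : 3 / 5 * δ * r ≤ X.card) (hYc : 3 / 5 * δ * r ≤ Y.card) :
    ∃ x ∈ X, ∃ y ∈ Y, x ∈ getParentsEGS δ y N := by
  induction r using Nat.strong_induction_on generalizing a X Y with
  | _ r ih =>
  have hpos : 0 < 3 / 5 * δ * r := by positivity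
  obtain ⟨x, hx⟩ := Finset.card_pos.1 (Nat.cast_pos.1 (hpos.trans_le hXc))
  obtain ⟨y, hy⟩ := Finset.card_pos.1 (Nat.cast_pos.1 (hpos.trans_le hYc))
  have hxa := Finset.mem_Ico.1 (hX hx)
  have hya := Finset.mem_Ico.1 (hY hy)
  have hxN := Finset.mem_Icc.1 (hXN hx)
  have hyN := Finset.mem_Icc.1 (hYN hy)
  -- All pairs are at distance less than `2r ≤ 4n`, so any pair is an edge.
  by_cases hrn : r ≤ 2 * n
  · refine ⟨x, hx, y, hy, Finset.mem_inter.2 ⟨Finset.mem_union_left _ ?_, hXN hx⟩⟩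
    rw [hN, Nat.log_pow one_lt_two, Finset.mem_Icc]
    omega
  have hr4 : 4 ≤ r := by
    rcases n with _ | _ | n
    · simp at hN
      omega
    · simp at hN
      omega
    · omega
  obtain ⟨r', hr'⟩ : ∃ r', r' = r / 2 := ⟨_, rfl⟩
  have hr'0 : r' ≠ 0 := by omega
  obtain ⟨t, ht⟩ : ∃ t, t = Nat.log 2 r' := ⟨_, rfl⟩
  have ht1 : 1 ≤ t := by
    rw [ht]
    exact Nat.log_pos one_lt_two (by omega)
  have hq1 : 2 ^ t ≤ r' := ht ▸ Nat.pow_log_le_self 2 hr'0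
  have hq2 : r' < 2 * 2 ^ t := by
    have := Nat.lt_pow_succ_log_self one_lt_two r'
    rw [← ht, pow_succ] at this
    omega
  have hq1R : (2 : ℝ) ^ t ≤ r' := by exact_mod_cast hq1
  have hr2R : 2 * (r' : ℝ) ≤ r := by exact_mod_cast (by omega : 2 * r' ≤ r)
  have hXsplit := Finset.card_filter_add_card_filter_not (s := X) (fun x => a + r - r' ≤ x)
  have hYsplit := Finset.card_filter_add_card_filter_not (s := Y) (fun y => y < a + r + r')
  apply_fun (Nat.cast : ℕ → ℝ) at hXsplit hYsplit
  rw [Nat.cast_add] at hXsplit hYsplit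
  by_cases hX' : 3 / 5 * δ * r' ≤ (X.filter fun x => a + r - r' ≤ x).card
  · by_cases hY' : 3 / 5 * δ * r' ≤ (Y.filter fun y => y < a + r + r').card
    · obtain ⟨x, hx, y, hy, h⟩ := ih r' (by omega) (a := a + r - r') (by omega)
        ((Finset.filter_subset _ _).trans hXN) ((Finset.filter_subset _ _).trans hYN)
        (fun x hx => by
          have h1 := Finset.mem_Ico.1 (hX (Finset.mem_filter.1 hx).1)
          have h2 := (Finset.mem_filter.1 hx).2
          rw [Finset.mem_Ico]
          omega)
        (fun y hy => by
          have h1 := Finset.mem_Ico.1 (hY (Finset.mem_filter.1 hy).1)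
          have h2 := (Finset.mem_filter.1 hy).2
          rw [Finset.mem_Ico]
          omega) hX' hY'
      exact ⟨x, (Finset.mem_filter.1 hx).1, y, (Finset.mem_filter.1 hy).1, h⟩
    · have hYout : ∀ y ∈ Y.filter fun y => ¬ y < a + r + r', a + r + r' ≤ y ∧ y < a + 2 * r :=
        fun y hy => ⟨not_lt.1 (Finset.mem_filter.1 hy).2,
          (Finset.mem_Ico.1 (hY (Finset.mem_filter.1 hy).1)).2⟩
      -- With `q = 2^t ≤ r' < 2q`, `X` meets at most 5 blocks and the outer part of `Y` at most 3.
      -- The latter needs `3 · (δ/5) · q` nodes, the source of the constant `3/5`.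
      obtain ⟨x, hx, y, hy, h⟩ := exists_edge_of_intervals h0 h1 (N := N) ht1 (p := a) (l := r)
        (K := 4) (p' := a + r + r') (l' := r - r') (K' := 2) (by omega) (by omega) (X := X)
        (Y := Y.filter fun y => ¬ y < a + r + r') hXN hX
        (fun y hy => by
          have := hYout y hy
          rw [Finset.mem_Ico]
          omega)
        (by push_cast; nlinarith) (by push_cast; nlinarith)
        (fun x hx y hy => by
          have := hYout y hy
          have := Finset.mem_Ico.1 (hX hx)
          omega)
        (fun x hx y hy => by
          have := hYout y hy
          have := Finset.mem_Ico.1 (hX hx)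
          omega)
      exact ⟨x, hx, y, (Finset.mem_filter.1 hy).1, h⟩
  · have hXout : ∀ x ∈ X.filter fun x => ¬ a + r - r' ≤ x, a ≤ x ∧ x < a + r - r' :=
      fun x hx => ⟨(Finset.mem_Ico.1 (hX (Finset.mem_filter.1 hx).1)).1,
        not_le.1 (Finset.mem_filter.1 hx).2⟩
    obtain ⟨x, hx, y, hy, h⟩ := exists_edge_of_intervals h0 h1 (N := N) ht1 (p := a)
      (l := r - r') (K := 2) (p' := a + r) (l' := r) (K' := 4) (by omega) (by omega)
      (X := X.filter fun x => ¬ a + r - r' ≤ x) (Y := Y) ((Finset.filter_subset _ _).trans hXN)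
      (fun x hx => by
        have := hXout x hx
        rw [Finset.mem_Ico]
        omega)
      (fun y hy => by
        have := Finset.mem_Ico.1 (hY hy)
        rw [Finset.mem_Ico]
        omega)
      (by push_cast; nlinarith) (by push_cast; nlinarith)
      (fun x hx y hy => by
        have := hXout x hx
        have := Finset.mem_Ico.1 (hY hy)
        omega)
      (fun x hx y hy => by
        have := hXout x hx
        have := Finset.mem_Ico.1 (hY hy)
        omega)
    exact ⟨x, (Finset.mem_filter.1 hx).1, y, hy, h⟩

/-! ### Nodes with few deleted neighbours -/

open scoped Classical in
/-- All intervals of `{1, 2, …}` that end at `v` keep at least the proportion `γ` of their nodes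
when the nodes in `s` are deleted. -/
def IsLeftGood (γ : ℝ) (s : ℕ → Prop) (v : ℕ) : Prop :=
  ∀ r, 1 ≤ r → r ≤ v → γ * r ≤ ((Finset.range r).filter fun i => ¬ s (v - i)).card

open scoped Classical in
/-- All intervals of `{…, N - 1, N}` that start at `u` keep at least the proportion `γ` of their
nodes when the nodes in `s` are deleted. -/
def IsRightGood (γ : ℝ) (s : ℕ → Prop) (N u : ℕ) : Prop :=
  ∀ r, 1 ≤ r → u + r ≤ N + 1 → γ * r ≤ ((Finset.range r).filter fun i => ¬ s (u + i)).card

-- Scan down from `n`: a bad node has a witness interval of length `r` with more than `(1 - γ) r`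
-- deleted nodes, which pays for all `r` of its nodes. Continue below that interval.
open scoped Classical in
theorem card_not_isLeftGood_le {γ : ℝ} (hγ : γ ≤ 1) (s : ℕ → Prop) (n : ℕ) :
    (1 - γ) * ((Finset.Icc 1 n).filter fun v => ¬ IsLeftGood γ s v).card ≤
      ((Finset.Icc 1 n).filter s).card := by
  induction n using Nat.strong_induction_on with
  | _ n ih =>
  rcases Nat.eq_zero_or_pos n with rfl | hn
  · simp
  by_cases hg : IsLeftGood γ s n
  · have h1 : ((Finset.Icc 1 n).filter fun v => ¬ IsLeftGood γ s v) ⊆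
        (Finset.Icc 1 (n - 1)).filter fun v => ¬ IsLeftGood γ s v := by
      intro v hv
      simp only [Finset.mem_filter, Finset.mem_Icc] at hv ⊢
      have : v ≠ n := by
        rintro rfl
        exact hv.2 hg
      exact ⟨by omega, hv.2⟩
    have h2 : (Finset.Icc 1 (n - 1)).filter s ⊆ (Finset.Icc 1 n).filter s :=
      Finset.filter_subset_filter _ (Finset.Icc_subset_Icc_right (by omega))
    calc _ ≤ (1 - γ) * ((Finset.Icc 1 (n - 1)).filter fun v => ¬ IsLeftGood γ s v).card :=
          mul_le_mul_of_nonneg_left (by exact_mod_cast Finset.card_le_card h1) (by linarith)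
      _ ≤ _ := ih (n - 1) (by omega)
      _ ≤ _ := by exact_mod_cast Finset.card_le_card h2
  · simp only [IsLeftGood, not_forall, not_le] at hg
    obtain ⟨r, hr1, hrn, hr⟩ := hg
    have hsplit : Finset.Icc 1 n = Finset.Icc 1 (n - r) ∪ Finset.Ioc (n - r) n := by
      ext x
      simp only [Finset.mem_union, Finset.mem_Icc, Finset.mem_Ioc]
      omega
    have hdisj : Disjoint (Finset.Icc 1 (n - r)) (Finset.Ioc (n - r) n) := by
      rw [Finset.disjoint_left]
      intro x hx hx'
      rw [Finset.mem_Icc] at hx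
      rw [Finset.mem_Ioc] at hx'
      omega
    have hbij : ((Finset.Ioc (n - r) n).filter s).card =
        ((Finset.range r).filter fun i => s (n - i)).card := by
      refine Finset.card_nbij' (fun x => n - x) (fun x => n - x) ?_ ?_ ?_ ?_
      · intro x hx
        simp only [Finset.coe_filter, Set.mem_ofPred_eq, Finset.mem_Ioc, Finset.mem_range] at hx ⊢
        rw [Nat.sub_sub_self hx.1.2]
        exact ⟨by omega, hx.2⟩
      · intro x hx
        simp only [Finset.coe_filter, Set.mem_ofPred_eq, Finset.mem_Ioc, Finset.mem_range] at hx ⊢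
        exact ⟨by omega, hx.2⟩
      · intro x hx
        simp only [Finset.coe_filter, Set.mem_ofPred_eq, Finset.mem_Ioc] at hx
        exact Nat.sub_sub_self hx.1.2
      · intro x hx
        simp only [Finset.coe_filter, Set.mem_ofPred_eq, Finset.mem_range] at hx
        exact Nat.sub_sub_self (by omega)
    have hcompl := Finset.card_filter_add_card_filter_not (s := Finset.range r) (fun i => s (n - i))
    rw [Finset.card_range, ← hbij] at hcompl
    have h1 : ((Finset.Icc 1 n).filter fun v => ¬ IsLeftGood γ s v).card ≤
        ((Finset.Icc 1 (n - r)).filter fun v => ¬ IsLeftGood γ s v).card + r := by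
      rw [hsplit, Finset.filter_union]
      refine (Finset.card_union_le _ _).trans (Nat.add_le_add_left ?_ _)
      refine (Finset.card_filter_le _ _).trans ?_
      rw [Nat.card_Ioc]
      omega
    have h2 : ((Finset.Icc 1 n).filter s).card =
        ((Finset.Icc 1 (n - r)).filter s).card + ((Finset.Ioc (n - r) n).filter s).card := by
      rw [hsplit, Finset.filter_union, Finset.card_union_of_disjoint]
      exact Finset.disjoint_filter_filter hdisj
    have h3 := ih (n - r) (by omega)
    apply_fun (Nat.cast : ℕ → ℝ) at hcompl h2
    rw [Nat.cast_add] at hcompl h2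
    have h1' := mul_le_mul_of_nonneg_left (Nat.cast_le (α := ℝ).2 h1)
      (show 0 ≤ 1 - γ by linarith)
    push_cast at h1'
    linarith

theorem card_filter_reflect (N : ℕ) (p : ℕ → Prop) [DecidablePred p]
    [DecidablePred fun v => p (N + 1 - v)] :
    ((Finset.Icc 1 N).filter fun v => p (N + 1 - v)).card = ((Finset.Icc 1 N).filter p).card := by
  refine Finset.card_nbij' (fun x => N + 1 - x) (fun x => N + 1 - x) ?_ ?_ ?_ ?_
  · intro x hx
    simp only [Finset.coe_filter, Set.mem_ofPred_eq, Finset.mem_Icc] at hx ⊢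
    exact ⟨by omega, hx.2⟩
  · intro x hx
    simp only [Finset.coe_filter, Set.mem_ofPred_eq, Finset.mem_Icc] at hx ⊢
    rw [Nat.sub_sub_self (by omega)]
    exact ⟨by omega, hx.2⟩
  · intro x hx
    simp only [Finset.coe_filter, Set.mem_ofPred_eq, Finset.mem_Icc] at hx
    exact Nat.sub_sub_self (by omega)
  · intro x hx
    simp only [Finset.coe_filter, Set.mem_ofPred_eq, Finset.mem_Icc] at hx
    exact Nat.sub_sub_self (by omega)

open scoped Classical in
theorem isRightGood_iff_isLeftGood {γ : ℝ} {s : ℕ → Prop} {N v : ℕ} (hv : v ≤ N) :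
    IsRightGood γ s N v ↔ IsLeftGood γ (fun x => s (N + 1 - x)) (N + 1 - v) := by
  refine forall_congr' fun r => imp_congr_right fun _ => ?_
  by_cases hr : v + r ≤ N + 1
  · have hr' : r ≤ N + 1 - v := by omega
    simp only [hr, hr', forall_const]
    have h : ((Finset.range r).filter fun i => ¬ s (v + i)) =
        (Finset.range r).filter fun i => ¬ s (N + 1 - (N + 1 - v - i)) := by
      refine Finset.filter_congr fun i hi => ?_
      rw [Finset.mem_range] at hi
      rw [show N + 1 - (N + 1 - v - i) = v + i by omega]
    rw [h]
  · have hr' : ¬ r ≤ N + 1 - v := by omega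
    simp only [hr, hr', false_imp_iff]

open scoped Classical in
theorem card_not_isRightGood_le {γ : ℝ} (hγ : γ ≤ 1) (s : ℕ → Prop) (N : ℕ) :
    (1 - γ) * ((Finset.Icc 1 N).filter fun v => ¬ IsRightGood γ s N v).card ≤
      ((Finset.Icc 1 N).filter s).card := by
  have h := card_not_isLeftGood_le hγ (fun x => s (N + 1 - x)) N
  rw [card_filter_reflect N s, ← card_filter_reflect N fun v => ¬ IsLeftGood γ (fun x => s (N + 1 - x)) v] at h
  rwa [Finset.filter_congr fun v hv => not_congr (isRightGood_iff_isLeftGood (Finset.mem_Icc.1 hv).2)]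

open scoped Classical in
/-- Most nodes keep a large proportion of all intervals around them. -/
theorem card_good_ge {γ : ℝ} (h0 : 0 < γ) (h1 : γ < 1) (s : ℕ → Prop) (N : ℕ) :
    (N : ℝ) - ((Finset.Icc 1 N).filter s).card * ((1 + γ) / (1 - γ)) ≤
      ((Finset.Icc 1 N).filter fun v => IsLeftGood γ s v ∧ IsRightGood γ s N v).card := by
  have hγ : 0 < 1 - γ := by linarith
  have hL := card_not_isLeftGood_le h1.le s N
  have hR := card_not_isRightGood_le h1.le s N
  set A := (Finset.Icc 1 N).filter fun v => ¬ IsLeftGood γ s v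
  set B := (Finset.Icc 1 N).filter fun v => ¬ IsRightGood γ s N v
  have hS : (Finset.Icc 1 N).filter s ⊆ A ∩ B := by
    intro v hv
    rw [Finset.mem_filter] at hv
    have hv' := Finset.mem_Icc.1 hv.1
    rw [Finset.mem_inter, Finset.mem_filter, Finset.mem_filter]
    refine ⟨⟨hv.1, fun h => ?_⟩, ⟨hv.1, fun h => ?_⟩⟩
    · have := h 1 le_rfl hv'.1
      simp [Finset.filter_singleton, hv.2] at this
      linarith
    · have := h 1 le_rfl (by omega)
      simp [Finset.filter_singleton, hv.2] at this
      linarith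
  have hU : Finset.Icc 1 N ⊆
      ((Finset.Icc 1 N).filter fun v => IsLeftGood γ s v ∧ IsRightGood γ s N v) ∪ (A ∪ B) := by
    intro v hv
    simp only [A, B, Finset.mem_union, Finset.mem_filter, hv, true_and]
    tauto
  have c1 := Finset.card_le_card hS
  have c2 := (Finset.card_le_card hU).trans (Finset.card_union_le _ _)
  have c3 := Finset.card_union_add_card_inter A B
  rw [Nat.card_Icc, Nat.add_sub_cancel] at c2
  have c1' : (((Finset.Icc 1 N).filter s).card : ℝ) ≤ (A ∩ B).card := by exact_mod_cast c1
  have c2' : (N : ℝ) ≤ ((Finset.Icc 1 N).filter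
    fun v => IsLeftGood γ s v ∧ IsRightGood γ s N v).card + (A ∪ B).card := by exact_mod_cast c2
  have c3' : ((A ∪ B).card : ℝ) + (A ∩ B).card = A.card + B.card := by exact_mod_cast c3
  set σ : ℝ := (((Finset.Icc 1 N).filter s).card : ℝ)
  -- Deleted nodes are bad on both sides, so inclusion-exclusion saves one copy of `σ`.
  have e1 : σ * ((1 + γ) / (1 - γ)) = 2 * (σ / (1 - γ)) - σ := by
    field_simp
    ring
  have e2 : (A.card : ℝ) ≤ σ / (1 - γ) := by
    rw [le_div_iff₀ hγ]
    linarith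
  have e3 : (B.card : ℝ) ≤ σ / (1 - γ) := by
    rw [le_div_iff₀ hγ]
    linarith
  linarith

/-! ### Good nodes are connected -/

-- Positions are distances from a fixed good node, so one statement serves both directions. If `[0,
-- h)` has at least `c * h` reached nodes, expansion leaves fewer than `c * h` alive unreached nodes
-- in `[h, 2h)`. These losses sum geometrically.
open scoped Classical in
theorem card_reached_ge {γ c : ℝ} (hc : 0 ≤ c) (hγ : 3 * c ≤ γ) {M : ℕ} {alive reach : ℕ → Prop}
    (h0 : reach 0)
    (halive : ∀ r, 1 ≤ r → r ≤ M → γ * r ≤ ((Finset.range r).filter alive).card)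
    (hexp : ∀ h, 0 < h → 2 * h ≤ M + 1 → ∀ X Y : Finset ℕ, X ⊆ Finset.range h →
      Y ⊆ Finset.Ico h (2 * h) → Y ⊆ Finset.range M → c * h ≤ X.card → c * h ≤ Y.card →
      (∀ i ∈ X, reach i) → (∀ i ∈ Y, alive i) → ∃ i ∈ Y, reach i)
    {r : ℕ} (hr : 1 ≤ r) (hrM : r ≤ M) :
    γ * r - 2 * c * (r - 1) ≤ ((Finset.range r).filter reach).card := by
  have hcount : ∀ r, 1 ≤ r → r ≤ M → γ * r -
      ((Finset.range r).filter fun i => alive i ∧ ¬ reach i).card ≤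
      ((Finset.range r).filter reach).card := by
    intro r hr hrM
    have h1 : (Finset.range r).filter alive ⊆
        ((Finset.range r).filter fun i => alive i ∧ ¬ reach i) ∪ (Finset.range r).filter reach := by
      intro i hi
      simp only [Finset.mem_union, Finset.mem_filter] at hi ⊢
      tauto
    have h2 : (((Finset.range r).filter alive).card : ℝ) ≤
        ((Finset.range r).filter fun i => alive i ∧ ¬ reach i).card +
        ((Finset.range r).filter reach).card := by
      exact_mod_cast (Finset.card_le_card h1).trans (Finset.card_union_le _ _)
    linarith [halive r hr hrM]
  suffices hU : (((Finset.range r).filter fun i => alive i ∧ ¬ reach i).card : ℝ) ≤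
      2 * c * (r - 1) by
    linarith [hcount r hr hrM]
  induction r using Nat.strong_induction_on with
  | _ r ih =>
  rcases hr.eq_or_lt with rfl | hr2
  · simp [Finset.filter_singleton, h0]
  obtain ⟨h, hh⟩ : ∃ h, h = (r + 1) / 2 := ⟨_, rfl⟩
  have hUh := ih h (by omega) (by omega) (by omega)
  have hreach := hcount h (by omega) (by omega)
  set Y := ((Finset.Ico h (2 * h)).filter fun i => alive i ∧ ¬ reach i).filter fun i => i < M
  have hhR : (1 : ℝ) ≤ h := by exact_mod_cast (by omega : 1 ≤ h)
  have hY : (Y.card : ℝ) < c * h := by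
    by_contra! hcon
    obtain ⟨i, hi, hi'⟩ := hexp h (by omega) (by omega) ((Finset.range h).filter reach) Y
      (Finset.filter_subset _ _) ((Finset.filter_subset _ _).trans (Finset.filter_subset _ _))
      (fun i hi => Finset.mem_range.2 (Finset.mem_filter.1 hi).2) (by nlinarith) hcon
      (fun i hi => (Finset.mem_filter.1 hi).2)
      (fun i hi => (Finset.mem_filter.1 (Finset.mem_filter.1 hi).1).2.1)
    exact (Finset.mem_filter.1 (Finset.mem_filter.1 hi).1).2.2 hi'
  have hsub : ((Finset.range r).filter fun i => alive i ∧ ¬ reach i) ⊆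
      ((Finset.range h).filter fun i => alive i ∧ ¬ reach i) ∪ Y := by
    intro i hi
    simp only [Y, Finset.mem_union, Finset.mem_filter, Finset.mem_range, Finset.mem_Ico] at hi ⊢
    rcases lt_or_ge i h with hlt | hge
    · exact Or.inl ⟨hlt, hi.2⟩
    · exact Or.inr ⟨⟨⟨hge, by omega⟩, hi.2⟩, by omega⟩
  have hcard : (((Finset.range r).filter fun i => alive i ∧ ¬ reach i).card : ℝ) ≤
      ((Finset.range h).filter fun i => alive i ∧ ¬ reach i).card + Y.card := by
    exact_mod_cast (Finset.card_le_card hsub).trans (Finset.card_union_le _ _)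
  -- The loss is at most `2c(h - 1) + ch = c(3h - 2)`; `3h ≤ 2r` uses `r ≥ 2`.
  have hrh : (3 * h - 2 : ℝ) ≤ 2 * (r - 1) := by
    have : 3 * h ≤ 2 * r := by omega
    have : (3 * h : ℝ) ≤ 2 * r := by exact_mod_cast this
    linarith
  nlinarith [mul_le_mul_of_nonneg_left hrh hc]

/-- The edges of `E` between nodes that are not deleted. -/
def SurvivingEdge (E : ℕ → ℕ → Prop) (s : ℕ → Prop) (x y : ℕ) : Prop := E x y ∧ ¬ s x ∧ ¬ s y

theorem connected_of_good {γ c : ℝ} (hc : 0 < c) (hγ : 3 * c ≤ γ) {N : ℕ} {E : ℕ → ℕ → Prop}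
    {s : ℕ → Prop}
    (hE : ∀ a r : ℕ, 0 < r → ∀ X Y : Finset ℕ, X ⊆ Finset.Icc 1 N → Y ⊆ Finset.Icc 1 N →
      X ⊆ Finset.Ico a (a + r) → Y ⊆ Finset.Ico (a + r) (a + 2 * r) → c * r ≤ X.card →
      c * r ≤ Y.card → ∃ x ∈ X, ∃ y ∈ Y, E x y)
    {u v : ℕ} (hu : 1 ≤ u) (huv : u < v) (hv : v ≤ N) (hus : ¬ s u) (hvs : ¬ s v)
    (hgu : IsRightGood γ s N u) (hgv : IsLeftGood γ s v) :
    Relation.ReflTransGen (SurvivingEdge E s) u v := by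
  classical
  have fwd := fun r => card_reached_ge hc.le hγ (M := N + 1 - u) (alive := fun i => ¬ s (u + i))
    (reach := fun i => ¬ s (u + i) ∧ Relation.ReflTransGen (SurvivingEdge E s) u (u + i))
    ⟨hus, .refl⟩ (fun r hr hrM => by convert hgu r hr (by omega))
    (fun h hh hhM X Y hX hY hYM hXc hYc hXr hYa => by
      have hinj : Function.Injective fun i => u + i := fun a b hab => by simpa using hab
      obtain ⟨x, hx, y, hy, hxy⟩ := hE u h hh (X.image fun i => u + i) (Y.image fun i => u + i)
        (Finset.image_subset_iff.2 fun i hi => by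
          have := Finset.mem_range.1 (hX hi)
          rw [Finset.mem_Icc]
          omega)
        (Finset.image_subset_iff.2 fun i hi => by
          have := Finset.mem_range.1 (hYM hi)
          rw [Finset.mem_Icc]
          omega)
        (Finset.image_subset_iff.2 fun i hi => by
          have := Finset.mem_range.1 (hX hi)
          rw [Finset.mem_Ico]
          omega)
        (Finset.image_subset_iff.2 fun i hi => by
          have := Finset.mem_Ico.1 (hY hi)
          rw [Finset.mem_Ico]
          omega)
        (by rwa [Finset.card_image_of_injective _ hinj])
        (by rwa [Finset.card_image_of_injective _ hinj])
      obtain ⟨i, hi, rfl⟩ := Finset.mem_image.1 hx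
      obtain ⟨j, hj, rfl⟩ := Finset.mem_image.1 hy
      exact ⟨j, hj, hYa j hj, (hXr i hi).2.tail ⟨hxy, (hXr i hi).1, hYa j hj⟩⟩) (r := r)
  have hinj : ∀ Z : Finset ℕ, Z ⊆ Finset.range v → Set.InjOn (fun i => v - i) Z := by
    intro Z hZ a ha b hb hab
    have := Finset.mem_range.1 (hZ ha)
    have := Finset.mem_range.1 (hZ hb)
    simp only at hab
    omega
  have bwd := fun r => card_reached_ge hc.le hγ (M := v) (alive := fun i => ¬ s (v - i))
    (reach := fun i => ¬ s (v - i) ∧ Relation.ReflTransGen (SurvivingEdge E s) (v - i) v)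
    ⟨hvs, .refl⟩ (fun r hr hrM => by convert hgv r hr hrM)
    (fun h hh hhM X Y hX hY hYM hXc hYc hXr hYa => by
      have hXM : X ⊆ Finset.range v := hX.trans (Finset.range_subset_range.2 (by omega))
      -- Reflection exchanges the two intervals. As `2h ≤ v + 1` the subtraction is exact, and the
      -- left end may be `0`.
      obtain ⟨x, hx, y, hy, hxy⟩ := hE (v + 1 - 2 * h) h hh
        (Y.image fun i => v - i) (X.image fun i => v - i)
        (Finset.image_subset_iff.2 fun i hi => by
          have := Finset.mem_range.1 (hYM hi)
          rw [Finset.mem_Icc]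
          omega)
        (Finset.image_subset_iff.2 fun i hi => by
          have := Finset.mem_range.1 (hXM hi)
          rw [Finset.mem_Icc]
          omega)
        (Finset.image_subset_iff.2 fun i hi => by
          have := Finset.mem_Ico.1 (hY hi)
          rw [Finset.mem_Ico]
          omega)
        (Finset.image_subset_iff.2 fun i hi => by
          have := Finset.mem_range.1 (hX hi)
          rw [Finset.mem_Ico]
          omega)
        (by rwa [Finset.card_image_of_injOn (hinj Y hYM)])
        (by rwa [Finset.card_image_of_injOn (hinj X hXM)])
      obtain ⟨j, hj, rfl⟩ := Finset.mem_image.1 hx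
      obtain ⟨i, hi, rfl⟩ := Finset.mem_image.1 hy
      exact ⟨j, hj, hYa j hj, .head ⟨hxy, hYa j hj, (hXr i hi).1⟩ (hXr i hi).2⟩) (r := r)
  -- Halve `[u, v]` into lengths `h` and `k` with `k ≤ h ≤ k + 1`. The shorter half still has `ck +
  -- 2c ≥ ch` nodes from which `v` is reached.
  obtain ⟨h, hh⟩ : ∃ h, h = (v - u + 2) / 2 := ⟨_, rfl⟩
  obtain ⟨k, hk⟩ : ∃ k, k = v + 1 - u - h := ⟨_, rfl⟩
  have hX := fwd h (by omega) (by omega)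
  have hY := bwd k (by omega) (by omega)
  set X := (Finset.range h).filter
    fun i => ¬ s (u + i) ∧ Relation.ReflTransGen (SurvivingEdge E s) u (u + i)
  set Y := (Finset.range k).filter
    fun i => ¬ s (v - i) ∧ Relation.ReflTransGen (SurvivingEdge E s) (v - i) v
  replace hX : γ * h - 2 * c * (h - 1) ≤ X.card := by convert hX
  replace hY : γ * k - 2 * c * (k - 1) ≤ Y.card := by convert hY
  have hhR : (1 : ℝ) ≤ h := by exact_mod_cast (by omega : 1 ≤ h)
  have hkR : (h : ℝ) ≤ k + 1 := by exact_mod_cast (by omega : h ≤ k + 1)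
  have hk0 : (0 : ℝ) ≤ k := Nat.cast_nonneg _
  obtain ⟨x, hx, y, hy, hxy⟩ := hE u h (by omega) (X.image fun i => u + i) (Y.image fun i => v - i)
    (Finset.image_subset_iff.2 fun i hi => by
      have := Finset.mem_range.1 (Finset.mem_filter.1 hi).1
      rw [Finset.mem_Icc]
      omega)
    (Finset.image_subset_iff.2 fun i hi => by
      have := Finset.mem_range.1 (Finset.mem_filter.1 hi).1
      rw [Finset.mem_Icc]
      omega)
    (Finset.image_subset_iff.2 fun i hi => by
      have := Finset.mem_range.1 (Finset.mem_filter.1 hi).1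
      rw [Finset.mem_Ico]
      omega)
    (Finset.image_subset_iff.2 fun i hi => by
      have := Finset.mem_range.1 (Finset.mem_filter.1 hi).1
      rw [Finset.mem_Ico]
      omega)
    (by
      rw [Finset.card_image_of_injective _ fun a b hab => by simpa using hab]
      nlinarith)
    (by
      rw [Finset.card_image_of_injOn (hinj Y ((Finset.filter_subset _ _).trans
        (Finset.range_subset_range.2 (by omega))))]
      nlinarith)
  obtain ⟨i, hi, rfl⟩ := Finset.mem_image.1 hx
  obtain ⟨j, hj, rfl⟩ := Finset.mem_image.1 hy
  have hi' := (Finset.mem_filter.1 hi).2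
  have hj' := (Finset.mem_filter.1 hj).2
  exact (hi'.2.tail ⟨hxy, hi'.1, hj'.1⟩).trans hj'.2

/-! ### Paths through good nodes -/

theorem exists_isChain_extending {α : Type*} {R : α → α → Prop} {A : α → Prop}
    (hA : ∀ x y, R x y → A x) {a b : α} (hab : Relation.ReflTransGen R a b) {p : List α}
    (hp : p.IsChain R) (hpA : ∀ x ∈ p, A x) (hb : p.head? = some b) :
    ∃ q : List α, q.IsChain R ∧ (∀ x ∈ q, A x) ∧ q.head? = some a ∧ p ⊆ q := by
  induction hab using Relation.ReflTransGen.head_induction_on with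
  | refl => exact ⟨p, hp, hpA, hb, List.Subset.refl _⟩
  | @head a c hac _ ih =>
    obtain ⟨q, h1, h2, h3, h4⟩ := ih
    refine ⟨a :: q, List.isChain_cons.2 ⟨fun y hy => ?_, h1⟩, ?_, rfl,
      List.subset_cons_of_subset _ h4⟩
    · rw [h3, Option.mem_some_iff] at hy
      exact hy ▸ hac
    · intro x hx
      rcases List.mem_cons.1 hx with rfl | hx
      · exact hA _ _ hac
      · exact h2 x hx

theorem exists_isChain_through {α : Type*} {R : α → α → Prop} {A : α → Prop}
    (hA : ∀ x y, R x y → A x) (l : List α) (hl : l.IsChain (Relation.ReflTransGen R))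
    (hlA : ∀ x ∈ l, A x) :
    ∃ p : List α, p.IsChain R ∧ (∀ x ∈ p, A x) ∧ p.head? = l.head? ∧ l ⊆ p := by
  induction l with
  | nil => exact ⟨[], by simp⟩
  | cons a l ih =>
    obtain ⟨p, h1, h2, h3, h4⟩ := ih hl.tail fun x hx => hlA x (List.mem_cons_of_mem _ hx)
    rcases l with _ | ⟨b, l⟩
    · exact ⟨[a], by simp, by simpa using hlA, rfl, List.Subset.refl _⟩
    · obtain ⟨q, q1, q2, q3, q4⟩ := exists_isChain_extending hA (List.isChain_cons_cons.1 hl).1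
        h1 h2 h3
      refine ⟨q, q1, q2, q3, List.cons_subset.2 ⟨List.mem_of_mem_head? q3, fun x hx => q4 (h4 hx)⟩⟩

/-- A graph on `{1, …, N}` with increasing edges in which large subsets of adjacent intervals are
joined by an edge is depth-robust. -/
theorem isDepthRobust_of_local_expander {N : ℕ} (G : Digraph (Finset.Icc 1 N))
    (hG : ∀ u v, G.Adj u v → u < v) {γ c : ℝ} (hc : 0 < c) (hγ : 3 * c ≤ γ) (hγ1 : γ < 1)
    (hE : ∀ a r : ℕ, 0 < r → ∀ X Y : Finset ℕ, X ⊆ Finset.Icc 1 N → Y ⊆ Finset.Icc 1 N →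
      X ⊆ Finset.Ico a (a + r) → Y ⊆ Finset.Ico (a + r) (a + 2 * r) → c * r ≤ X.card →
      c * r ≤ Y.card → ∃ x ∈ X, ∃ y ∈ Y, ∃ hx hy, G.Adj ⟨x, hx⟩ ⟨y, hy⟩) (e : ℕ) :
    IsDepthRobust G e ((N : ℝ) - (e : ℝ) * ((1 + γ) / (1 - γ))) := by
  classical
  intro S hS
  have hγ0 : 0 < γ := by linarith
  obtain ⟨s, hs⟩ : ∃ s : ℕ → Prop, ∀ x, s x ↔ ∃ hx, (⟨x, hx⟩ : Finset.Icc 1 N) ∈ S :=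
    ⟨_, fun _ => Iff.rfl⟩
  let E : ℕ → ℕ → Prop := fun x y => ∃ hx hy, G.Adj ⟨x, hx⟩ ⟨y, hy⟩
  let A : ℕ → Prop := fun x => x ∈ Finset.Icc 1 N ∧ ¬ s x
  have hcard := card_good_ge hγ0 hγ1 s N
  set T := (Finset.Icc 1 N).filter fun v => IsLeftGood γ s v ∧ IsRightGood γ s N v with hT
  have hTA : ∀ v ∈ T, A v ∧ IsLeftGood γ s v ∧ IsRightGood γ s N v := by
    intro v hv
    obtain ⟨h1, h2, h3⟩ := Finset.mem_filter.1 hv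
    refine ⟨⟨h1, fun h => ?_⟩, h2, h3⟩
    have := h2 1 le_rfl (Finset.mem_Icc.1 h1).1
    simp [Finset.filter_singleton, h] at this
    linarith
  have hscard : (((Finset.Icc 1 N).filter s).card : ℝ) ≤ e := by
    refine Nat.cast_le.2 (le_trans ?_ hS)
    rw [← Finset.card_image_of_injective S Subtype.val_injective]
    refine Finset.card_le_card fun x hx => ?_
    obtain ⟨hx, h⟩ := (hs x).1 (Finset.mem_filter.1 hx).2
    exact Finset.mem_image.2 ⟨⟨x, hx⟩, h, rfl⟩
  obtain ⟨p, hp, hpA, -, hTp⟩ := exists_isChain_through (R := SurvivingEdge E s) (A := A)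
    (fun x y h => ⟨h.1.1, h.2.1⟩) T.sort (by
      refine List.Pairwise.isChain ?_
      refine List.Pairwise.imp_of_mem ?_ (Finset.sortedLT_sort T).pairwise
      intro u v hu hv huv
      obtain ⟨⟨u1, u2⟩, -, u3⟩ := hTA u ((Finset.mem_sort _).1 hu)
      obtain ⟨⟨v1, v2⟩, v3, -⟩ := hTA v ((Finset.mem_sort _).1 hv)
      exact connected_of_good hc hγ hE (Finset.mem_Icc.1 u1).1 huv (Finset.mem_Icc.1 v1).2
        u2 v2 u3 v3)
    (fun x hx => (hTA x ((Finset.mem_sort _).1 hx)).1)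
  lift p to List (Finset.Icc 1 N) using fun x hx => (hpA x hx).1
  have hchain : p.IsChain G.Adj := by
    rw [List.isChain_map] at hp
    exact hp.imp fun x y h => h.1.2.2
  refine ⟨p, hchain, ?_, ?_, ?_⟩
  · exact ((List.isChain_iff_pairwise.1 (hchain.imp hG)).imp fun h => h.ne)
  · intro v hv hvS
    exact (hpA v (List.mem_map_of_mem hv)).2 ((hs v).2 ⟨v.2, hvS⟩)
  · have h1 : T ⊆ (p.map Subtype.val).toFinset := fun x hx =>
      List.mem_toFinset.2 (hTp ((Finset.mem_sort _).2 hx))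
    have h2 : T.card ≤ p.length := by
      have := (Finset.card_le_card h1).trans (List.toFinset_card_le _)
      rwa [List.length_map] at this
    have h3 : (T.card : ℝ) ≤ p.length := by exact_mod_cast h2
    refine le_trans (le_trans (sub_le_sub_left ?_ _) hcard) (le_trans ?_ h3)
    · refine mul_le_mul_of_nonneg_right hscard ?_
      exact div_nonneg (by linarith) (by linarith)
    · rw [hT]

end DepthRobust

theorem mainTheorem2 (δ γ : ℝ) (hδ : 0 < δ) (hδ' : δ < 1 / 4) (hγ : 2 * δ < γ) (hγ' : γ < 1)
    (n N : ℕ) (hN : N = 2 ^ n) (e : ℕ) (he : e ≤ N) :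
    DepthRobust.IsDepthRobust (DepthRobust.egsGraph δ N) e
      ((N : ℝ) - (e : ℝ) * ((1 + γ) / (1 - γ))) := by
  -- The requirement `3c ≤ γ` holds because `3c = 9δ/5 < 2δ < γ`.
  refine DepthRobust.isDepthRobust_of_local_expander _
    (fun u v h => DepthRobust.egsGraph_adj_lt h) (c := 3 / 5 * δ) (by positivity) (by linarith) hγ'
    (fun a r hr X Y hXN hYN hX hY hXc hYc => ?_) e
  obtain ⟨x, hx, y, hy, h⟩ :=
    DepthRobust.egs_local_expander hδ hδ' hN hr hXN hYN hX hY hXc hYc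
  refine ⟨x, hx, y, hy, hXN hx, hYN hy, h, fun heq => ?_⟩
  have h1 := Finset.mem_Ico.1 (hX hx)
  have h2 := Finset.mem_Ico.1 (hY hy)
  have h3 : x = y := congrArg Subtype.val heq
  omega
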